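/- Let $G$ be a countably infinite discrete group. A finite set $S\subseteq G$ is called admissible if $S=S^{-1}$ and $e_G\in S$. A free p.m.p. action $G\curvearrowright(X,\mu)$ is an action of $G$ by measure-preserving transformations on a standard Borel space $X$ with a Borel probability measure $\mu$, such that the set of all $x\in X$ with $sx\neq x$ for every $s\in G\setminus\{e_G\}$ has measure one. For $S\subseteq G$, an $S$-path of length $n$ in $X$ is a tuple $(x_0,\dots,x_n)$ of points of $X$ such that for every $1\le i\le n$ there is a $g\in S$ with $x_i=gx_{i-1}$; it connects $x_0$ to $x_n$. The group $G$ has the shrinking property if there is an admissible $S_1\subseteq G$ such that for every $\varepsilon>0$ there is an admissible $S\subseteq G$ such that for every $\delta>0$ there is a $C\in\mathbb{N}$ such that for every free p.m.p. action $G\curvearrowright(X,\mu)$ there are Borel sets $Z\subseteq\mathcal{V}\subseteq X$ satisfying: (i) $S\mathcal{V}=X$; (ii) $\mu(\mathcal{V})\le\varepsilon$ and $\mu(Z)\le\delta$; (iii) every point of $\mathcal{V}$ is connected to some point of $Z$ by an $S_1$-path of length at most $C$ all of whose points belong to $\mathcal{V}$. Proposition. A countably infinite group $G$ has the shrinking property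 if and only if it is neither locally finite (every finitely generated subgroup is finite) nor virtually cyclic (there is a cyclic subgroup of finite index). -/

import Mathlib

open MeasureTheory
open scoped Pointwise

universe u v

/-- A group is locally finite if each of its finitely generated subgroups is finite. -/
def IsLocallyFiniteGroup (G : Type u) [Group G] : Prop :=
  ∀ H : Subgroup G, H.FG → Finite H

/-- A group is virtually cyclic if it has a cyclic subgroup of finite index. -/
def IsVirtuallyCyclic (G : Type u) [Group G] : Prop :=
  ∃ H : Subgroup G, H.FiniteIndex ∧ IsCyclic H

/-- The finite set `S` is symmetric and contains the identity. -/
def IsSymmWithOne {G : Type u} [Group G] (S : Finset G) : Prop :=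
  1 ∈ S ∧ ∀ g ∈ S, g⁻¹ ∈ S

/-- The action of `G` on `(X, μ)` is free and probability-measure preserving: every element of `G`
acts by a measure-preserving transformation, and the set of points with trivial stabilizer
has full measure. -/
structure IsFreePMP (G : Type u) [Group G] {X : Type v} [MeasurableSpace X] [MulAction G X]
    (μ : Measure X) : Prop where
  isProbabilityMeasure : IsProbabilityMeasure μ
  measurePreserving : ∀ g : G, MeasurePreserving (fun x : X => g • x) μ μ
  free : ∀ᵐ x ∂μ, ∀ s : G, s ≠ 1 → s • x ≠ x

/-- The tuple `(p 0, …, p n)` is an `S`-path (of length `n`). -/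
def IsActionPath {G : Type u} [Group G] {X : Type v} [MulAction G X] (S : Finset G) {n : ℕ}
    (p : Fin (n + 1) → X) : Prop :=
  ∀ i : Fin n, ∃ g ∈ S, p i.succ = g • p i.castSucc

/-- The shrinking property of a group `G`; the free p.m.p. actions range over all
standard probability spaces. -/
def HasShrinkingProperty (G : Type u) [Group G] : Prop :=
  ∃ S₁ : Finset G, IsSymmWithOne S₁ ∧
    ∀ ε : ℝ, 0 < ε → ∃ S : Finset G, IsSymmWithOne S ∧
      ∀ δ : ℝ, 0 < δ → ∃ C : ℕ,
        ∀ (X : Type v) [MeasurableSpace X] [StandardBorelSpace X] [MulAction G X]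
          (μ : Measure X), IsFreePMP G μ →
          ∃ Z V : Set X, MeasurableSet Z ∧ MeasurableSet V ∧ Z ⊆ V ∧
            (S : Set G) • V = Set.univ ∧
            μ V ≤ ENNReal.ofReal ε ∧ μ Z ≤ ENNReal.ofReal δ ∧
            ∀ x ∈ V, ∃ n : ℕ, n ≤ C ∧ ∃ p : Fin (n + 1) → X,
              IsActionPath S₁ p ∧ p 0 = x ∧ p (Fin.last n) ∈ Z ∧ ∀ i, p i ∈ V

/-! Existence. The shrinking property passes up from a subgroup. If some finitely generated subgroup
is not virtually cyclic, its balls satisfy |S^r| ≥ K r for suitable r, for every K. A Borel r-net Y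
then has measure at most 1/(K r), and routes of about 4r points from each net point towards a far
sparser set W cost O(1/K) in total. So V, made of W and the routes, is small uniformly in δ, and
only W depends on δ. The growth bound comes from minimal words: few elements on one large sphere
force periodic words, so G is a finite union of cosets of cyclic subgroups, and one of these
subgroups has finite index.

If all finitely generated subgroups are virtually cyclic but G is neither virtually cyclic nor
locally finite, there is an a of infinite order with ⟨a⟩ of infinite index, and every t normalizes
some ⟨a^q⟩ with q > 0. Then V consists of long ⟨a⟩-segments around a sparse set Y: translates by
finitely many coset representatives make V as sparse as required, and finitely many group elements
still carry V onto X.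

Obstruction, tested on a Bernoulli action. If ⟨S₁⟩ is finite, a path in V reaches only boundedly
many points, so a small Z forces a small V, against S V = X. If G is virtually cyclic, each orbit is
a thickened line. A sparse V leaves gaps that S₁-paths cannot jump, while S V = X forces V to
reappear soon after each gap. So Z meets the stretches between gaps with a frequency bounded below
independently of δ. -/

/-! ### Borel maximal independent sets -/

theorem exists_measurableSet_cover_isolating {X : Type*} [MeasurableSpace X]
    [StandardBorelSpace X] :
    ∃ A : ℕ → Set X, (∀ n, MeasurableSet (A n)) ∧
      ∀ (x : X) (s : Set X), s.Finite → x ∉ s → ∃ n, x ∈ A n ∧ Disjoint s (A n) := by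
  have hφ := measurableEmbedding_embeddingReal X
  obtain ⟨e, he⟩ := exists_surjective_nat (ℚ × ℚ)
  refine ⟨fun n => embeddingReal X ⁻¹' Set.Ioo ((e n).1 : ℝ) ((e n).2 : ℝ),
    fun n => hφ.measurable measurableSet_Ioo, fun x s hs hx => ?_⟩
  have hopen : IsOpen ((embeddingReal X '' s)ᶜ) := (hs.image _).isClosed.isOpen_compl
  have hmem : embeddingReal X x ∈ (embeddingReal X '' s)ᶜ := by
    rintro ⟨y, hy, hxy⟩
    exact hx (hφ.injective hxy ▸ hy)
  obtain ⟨a, b, hab, hsub⟩ := mem_nhds_iff_exists_Ioo_subset.1 (hopen.mem_nhds hmem)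
  obtain ⟨p, hp1, hp2⟩ := exists_rat_btwn hab.1
  obtain ⟨q, hq1, hq2⟩ := exists_rat_btwn hab.2
  obtain ⟨n, hn⟩ := he (p, q)
  refine ⟨n, by simp [hn, hp2, hq1], Set.disjoint_left.2 fun y hy hyA => ?_⟩
  simp only [hn, Set.mem_preimage, Set.mem_Ioo] at hyA
  exact hsub ⟨hp1.trans hyA.1, hyA.2.trans hq2⟩ ⟨y, hy, rfl⟩

/-- Every finite symmetric set of group elements admits a Borel maximal independent set. -/
theorem exists_measurableSet_maximal_independent {G : Type*} [Group G] {X : Type*}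
    [MeasurableSpace X] [StandardBorelSpace X] [MulAction G X]
    (hm : ∀ g : G, Measurable (fun x : X => g • x)) {F : Finset G} (hF : IsSymmWithOne F) :
    ∃ Y : Set X, MeasurableSet Y ∧ (∀ y ∈ Y, ∀ f ∈ F, f • y ∈ Y → f • y = y) ∧
      ∀ x, ∃ f ∈ F, f • x ∈ Y := by
  obtain ⟨A, hAm, hA⟩ := exists_measurableSet_cover_isolating (X := X)
  have hpre : ∀ (g : G) {B : Set X}, MeasurableSet B → MeasurableSet {x | g • x ∈ B} :=
    fun g B hB => hm g hB
  have hfix : ∀ g : G, MeasurableSet {x : X | g • x = x} := fun g =>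
    measurableSet_eq_fun (hm g) measurable_id
  -- Each `A' n` is itself `F`-independent, so at stage n the greedy construction may add at once
  -- all of its points that do not conflict with earlier ones.
  let A' : ℕ → Set X := fun n => {x | x ∈ A n ∧ ∀ f ∈ F, f • x ∈ A n → f • x = x}
  have hA'm : ∀ n, MeasurableSet (A' n) := fun n => by
    have : A' n = A n ∩ ⋂ f ∈ F, ({x | f • x ∈ A n}ᶜ ∪ {x | f • x = x}) := by
      ext x; simp [A', imp_iff_not_or]
    rw [this]
    exact (hAm n).inter (Finset.measurableSet_biInter _ fun f _ =>
      (hpre f (hAm n)).compl.union (hfix f))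
  have hcov : ∀ x, ∃ n, x ∈ A' n := fun x => by
    obtain ⟨n, hn, hd⟩ := hA x (((fun f : G => f • x) '' F) \ {x})
      ((F.finite_toSet.image _).subset Set.sdiff_subset) (by simp)
    refine ⟨n, hn, fun f hf hfx => ?_⟩
    by_contra hne
    exact Set.disjoint_left.1 hd ⟨⟨f, hf, rfl⟩, hne⟩ hfx
  let Y : ℕ → Set X := fun n =>
    Nat.rec ∅ (fun n Yn => Yn ∪ {x | x ∈ A' n ∧ ∀ f ∈ F, f • x ∉ Yn}) n
  have hYs : ∀ n, Y (n + 1) = Y n ∪ {x | x ∈ A' n ∧ ∀ f ∈ F, f • x ∉ Y n} := fun n => rfl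
  have hYm : ∀ n, MeasurableSet (Y n) := fun n => by
    induction n with
    | zero => exact MeasurableSet.empty
    | succ n ih =>
      rw [hYs]
      have : {x | x ∈ A' n ∧ ∀ f ∈ F, f • x ∉ Y n} =
          A' n ∩ ⋂ f ∈ F, {x | f • x ∈ Y n}ᶜ := by ext x; simp
      rw [this]
      exact ih.union ((hA'm n).inter (Finset.measurableSet_biInter _ fun f _ =>
        (hpre f ih).compl))
  have hmono : Monotone Y := monotone_nat_of_le_succ fun n => by
    rw [hYs]; exact Set.subset_union_left
  have hind : ∀ n, ∀ y ∈ Y n, ∀ f ∈ F, f • y ∈ Y n → f • y = y := fun n => by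
    induction n with
    | zero => intro y hy; exact hy.elim
    | succ n ih =>
      intro y hy f hf hfy
      rw [hYs] at hy hfy
      rcases hy with hy | hy <;> rcases hfy with hfy | hfy
      · exact ih y hy f hf hfy
      · exact absurd (by simpa using hy) (hfy.2 f⁻¹ (hF.2 f hf))
      · exact absurd hfy (hy.2 f hf)
      · exact hy.1.2 f hf hfy.1.1
  refine ⟨⋃ n, Y n, MeasurableSet.iUnion hYm, fun y hy f hf hfy => ?_, fun x => ?_⟩
  · obtain ⟨i, hi⟩ := Set.mem_iUnion.1 hy
    obtain ⟨j, hj⟩ := Set.mem_iUnion.1 hfy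
    exact hind (max i j) y (hmono (le_max_left _ _) hi) f hf (hmono (le_max_right _ _) hj)
  · obtain ⟨n, hn⟩ := hcov x
    rcases Classical.em (∀ f ∈ F, f • x ∉ Y n) with h | h
    · refine ⟨1, hF.1, Set.mem_iUnion.2 ⟨n + 1, ?_⟩⟩
      rw [one_smul, hYs]
      exact Or.inr ⟨hn, h⟩
    · push Not at h
      obtain ⟨f, hf, hfx⟩ := h
      exact ⟨f, hf, Set.mem_iUnion.2 ⟨n, hfx⟩⟩

/-! ### Measure bounds, reachability inside V, and passage to subgroups -/

theorem IsFreePMP.measurable_smul {G : Type*} [Group G] {X : Type*} [MeasurableSpace X]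
    [MulAction G X] {μ : Measure X} (h : IsFreePMP G μ) (g : G) :
    Measurable (fun x : X => g • x) :=
  (h.measurePreserving g).measurable

theorem IsFreePMP.measurableSet_smul {G : Type*} [Group G] {X : Type*} [MeasurableSpace X]
    [MulAction G X] {μ : Measure X} (h : IsFreePMP G μ) (g : G) {A : Set X}
    (hA : MeasurableSet A) : MeasurableSet (g • A) := by
  rw [← Set.preimage_smul_inv]
  exact h.measurable_smul g⁻¹ hA

theorem IsFreePMP.measure_smul {G : Type*} [Group G] {X : Type*} [MeasurableSpace X]
    [MulAction G X] {μ : Measure X} (h : IsFreePMP G μ) (g : G) {A : Set X}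
    (hA : MeasurableSet A) : μ (g • A) = μ A := by
  rw [← Set.preimage_smul_inv]
  exact (h.measurePreserving g⁻¹).measure_preimage hA.nullMeasurableSet

/-- The translates of an `F`-independent set by the elements of `E` are essentially disjoint as
soon as `E⁻¹ E ⊆ F`. -/
theorem IsFreePMP.card_mul_measure_le_one {G : Type*} [Group G] {X : Type*} [MeasurableSpace X]
    [MulAction G X] {μ : Measure X} (h : IsFreePMP G μ) {F E : Finset G} {Y : Set X}
    (hY : MeasurableSet Y) (hind : ∀ y ∈ Y, ∀ f ∈ F, f • y ∈ Y → f • y = y)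
    (hE : ∀ f ∈ E, ∀ g ∈ E, g⁻¹ * f ∈ F) : (E.card : ENNReal) * μ Y ≤ 1 := by
  have := h.isProbabilityMeasure
  have hd : (E : Set G).Pairwise (Function.onFun (AEDisjoint μ) fun g => g • Y) := by
    intro f hf g hg hfg
    refine measure_mono_null (fun x hx => ?_)
      (ae_iff.1 ((h.measurePreserving g⁻¹).quasiMeasurePreserving.ae h.free))
    obtain ⟨⟨y, hy, rfl⟩, z, hz, hzy⟩ := hx
    dsimp only at hzy
    have hz' : z = (g⁻¹ * f) • y := by rw [mul_smul, ← hzy, inv_smul_smul]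
    have hzy' : (g⁻¹ * f) • y = y := hind y hy _ (hE f hf g hg) (hz' ▸ hz)
    refine fun hfree => hfree (g⁻¹ * f) (fun he => hfg (inv_mul_eq_one.1 he).symm) ?_
    rw [← mul_smul g⁻¹, hzy', hzy']
  calc (E.card : ENNReal) * μ Y = ∑ g ∈ E, μ (g • Y) := by
        rw [Finset.sum_congr rfl fun g _ => h.measure_smul g hY]; simp
    _ = μ (⋃ g ∈ E, g • Y) :=
        (measure_biUnion_finset₀ hd fun g _ => (h.measurableSet_smul g hY).nullMeasurableSet).symm
    _ ≤ 1 := prob_le_one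

/-- The points of `V` from which `Z` can be reached by an `S`-path of length `n` inside `V`. -/
def reachSet {G : Type*} [Group G] {X : Type*} [MulAction G X] (S : Finset G) (V Z : Set X) :
    ℕ → Set X
  | 0 => Z ∩ V
  | n + 1 => {x | x ∈ V ∧ ∃ s ∈ S, s • x ∈ reachSet S V Z n}

theorem reachSet_subset {G : Type*} [Group G] {X : Type*} [MulAction G X] {S : Finset G}
    {V Z : Set X} {n : ℕ} : reachSet S V Z n ⊆ V := by
  cases n with
  | zero => exact Set.inter_subset_right
  | succ n => exact fun x hx => hx.1

theorem reachSet_mono {G : Type*} [Group G] {X : Type*} [MulAction G X] {S : Finset G}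
    (hS : 1 ∈ S) {V Z : Set X} : Monotone (reachSet S V Z) :=
  monotone_nat_of_le_succ fun _ x hx => ⟨reachSet_subset hx, 1, hS, by rwa [one_smul]⟩

theorem exists_isActionPath_of_mem_reachSet {G : Type*} [Group G] {X : Type*} [MulAction G X]
    {S : Finset G} {V Z : Set X} {n : ℕ} {x : X} (hx : x ∈ reachSet S V Z n) :
    ∃ p : Fin (n + 1) → X, IsActionPath S p ∧ p 0 = x ∧ p (Fin.last n) ∈ Z ∧ ∀ i, p i ∈ V := by
  induction n generalizing x with
  | zero => exact ⟨fun _ => x, fun i => i.elim0, rfl, hx.1, fun _ => hx.2⟩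
  | succ n ih =>
    obtain ⟨hxV, s, hs, hsx⟩ := hx
    obtain ⟨p, hp, h0, hl, hV⟩ := ih hsx
    refine ⟨Fin.cons x p, fun i => ?_, rfl, ?_, fun i => ?_⟩
    · refine Fin.cases ⟨s, hs, ?_⟩ (fun j => ?_) i
      · simpa using h0
      · obtain ⟨g, hg, hgp⟩ := hp j
        refine ⟨g, hg, ?_⟩
        rw [← Fin.succ_castSucc, Fin.cons_succ, Fin.cons_succ, hgp]
    · rw [← Fin.succ_last, Fin.cons_succ]; exact hl
    · refine Fin.cases hxV (fun j => ?_) i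
      rw [Fin.cons_succ]; exact hV j

/-- A path `q 0, …, q m` inside `V` that ends in `reachSet S V Z n`. -/
theorem mem_reachSet_of_path {G : Type*} [Group G] {X : Type*} [MulAction G X] {S : Finset G}
    {V Z : Set X} {m n : ℕ} {q : ℕ → X} (hq : ∀ i < m, ∃ s ∈ S, q (i + 1) = s • q i)
    (hV : ∀ i < m, q i ∈ V) (hm : q m ∈ reachSet S V Z n) : q 0 ∈ reachSet S V Z (n + m) := by
  induction m generalizing q with
  | zero => exact hm
  | succ m ih =>
    have h1 : q 1 ∈ reachSet S V Z (n + m) :=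
      ih (q := fun i => q (i + 1)) (fun i hi => hq (i + 1) (by lia))
        (fun i hi => hV (i + 1) (by lia)) hm
    obtain ⟨s, hs, hs'⟩ := hq 0 (by lia)
    exact ⟨hV 0 (by lia), s, hs, hs' ▸ h1⟩

theorem IsFreePMP.subgroup {G : Type*} [Group G] {X : Type*} [MeasurableSpace X]
    [MulAction G X] {μ : Measure X} (h : IsFreePMP G μ) (H : Subgroup G) : IsFreePMP H μ where
  isProbabilityMeasure := h.isProbabilityMeasure
  measurePreserving g := h.measurePreserving (g : G)
  free := h.free.mono fun x hx s hs => hx s (by simpa using hs)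

theorem HasShrinkingProperty.of_subgroup {G : Type u} [Group G] (H : Subgroup G)
    (h : HasShrinkingProperty.{u, v} H) : HasShrinkingProperty.{u, v} G := by
  classical
  have hmap : ∀ S : Finset H, IsSymmWithOne S → IsSymmWithOne (S.image ((↑) : H → G)) :=
    fun S hS => ⟨Finset.mem_image.2 ⟨1, hS.1, rfl⟩, fun g hg => by
      obtain ⟨a, ha, rfl⟩ := Finset.mem_image.1 hg
      exact Finset.mem_image.2 ⟨a⁻¹, hS.2 a ha, rfl⟩⟩
  obtain ⟨S₁, hS₁, h⟩ := h
  refine ⟨_, hmap S₁ hS₁, fun ε hε => ?_⟩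
  obtain ⟨S, hS, h⟩ := h ε hε
  refine ⟨_, hmap S hS, fun δ hδ => ?_⟩
  obtain ⟨C, h⟩ := h δ hδ
  refine ⟨C, fun X _ _ _ μ hμ => ?_⟩
  obtain ⟨Z, V, hZ, hV, hZV, hSV, hμV, hμZ, hp⟩ := h X μ (hμ.subgroup H)
  refine ⟨Z, V, hZ, hV, hZV, Set.eq_univ_of_forall fun x => ?_, hμV, hμZ, fun x hx => ?_⟩
  · obtain ⟨s, hs, v, hv, rfl⟩ := Set.mem_smul.1 (hSV ▸ Set.mem_univ x)
    exact Set.mem_smul.2 ⟨s, by simpa using hs, v, hv, rfl⟩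
  · obtain ⟨n, hn, p, hp, h'⟩ := hp x hx
    refine ⟨n, hn, p, fun i => ?_, h'⟩
    obtain ⟨g, hg, hgp⟩ := hp i
    exact ⟨g, Finset.mem_image.2 ⟨g, hg, rfl⟩, hgp⟩

/-! ### Minimal words and superlinear growth -/

theorem List.Lex.append_right_of_length_eq {α : Type*} {r : α → α → Prop} {s t : List α}
    (h : List.Lex r s t) (hlen : s.length = t.length) (u : List α) :
    List.Lex r (s ++ u) (t ++ u) := by
  induction h with
  | nil => simp at hlen
  | cons h ih => exact List.Lex.cons (ih (by simpa using hlen))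
  | rel h => exact List.Lex.rel h

theorem List.Shortlex.append_both {α : Type*} {r : α → α → Prop} {s t : List α}
    (h : List.Shortlex r s t) (a c : List α) :
    List.Shortlex r (a ++ s ++ c) (a ++ t ++ c) := by
  rw [List.append_assoc, List.append_assoc]
  refine List.Shortlex.append_left ?_ a
  rcases List.shortlex_def.1 h with h | ⟨hl, h⟩
  · exact List.Shortlex.of_length_lt (by simpa using h)
  · exact List.Shortlex.of_lex (by simp [hl]) (h.append_right_of_length_eq hl c)

/-- The word `l` in the letters `S` is the shortlex-least one representing its product. -/
def IsShortlexMin {G : Type*} [Group G] (S : Finset G) (l : List G) : Prop :=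
  (∀ x ∈ l, x ∈ S) ∧ ∀ l' : List G, (∀ x ∈ l', x ∈ S) → l'.prod = l.prod →
    ¬ List.Shortlex WellOrderingRel l' l

section Words

variable {G : Type*} [Group G] {S : Finset G}

/-- A smaller word for the factor could be substituted in place, which would make the whole word
smaller. -/
theorem IsShortlexMin.factor {a b c : List G} (h : IsShortlexMin S (a ++ b ++ c)) :
    IsShortlexMin S b := by
  refine ⟨fun x hx => h.1 x (by simp [hx]), fun l' hl' hp hlt => ?_⟩
  refine h.2 (a ++ l' ++ c) (fun x hx => ?_) (by simp [hp]) (hlt.append_both a c)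
  simp only [List.mem_append] at hx
  rcases hx with (hx | hx) | hx
  · exact h.1 x (by simp [hx])
  · exact hl' x hx
  · exact h.1 x (by simp [hx])

theorem IsShortlexMin.window {l : List G} (h : IsShortlexMin S l) (i n : ℕ) :
    IsShortlexMin S ((l.drop i).take n) := by
  refine IsShortlexMin.factor (a := l.take i) (c := (l.drop i).drop n) ?_
  rwa [List.append_assoc, List.take_append_drop, List.take_append_drop]

theorem IsShortlexMin.eq_of_prod_eq {l l' : List G} (h : IsShortlexMin S l)
    (h' : IsShortlexMin S l') (hp : l.prod = l'.prod) : l = l' := by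
  by_contra hne
  exact hne (Std.Trichotomous.trichotomous (r := List.Shortlex (WellOrderingRel (α := G))) l l'
    (h'.2 l h.1 hp) (h.2 l' h'.1 hp.symm))

theorem exists_isShortlexMin {l : List G} (hl : ∀ x ∈ l, x ∈ S) :
    ∃ l' : List G, IsShortlexMin S l' ∧ l'.prod = l.prod := by
  have hwf : WellFounded (List.Shortlex (WellOrderingRel (α := G))) :=
    List.Shortlex.wf IsWellFounded.wf
  obtain ⟨m, ⟨hmS, hmp⟩, hmin⟩ :=
    hwf.has_min {l' : List G | (∀ x ∈ l', x ∈ S) ∧ l'.prod = l.prod} ⟨l, hl, rfl⟩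
  exact ⟨m, ⟨hmS, fun l' hl' hp => hmin l' ⟨hl', hp.trans hmp⟩⟩, hmp⟩

theorem Finset.mem_pow_iff_exists_list [DecidableEq G] {n : ℕ} {g : G} :
    g ∈ S ^ n ↔ ∃ l : List G, l.length = n ∧ (∀ x ∈ l, x ∈ S) ∧ l.prod = g := by
  induction n generalizing g with
  | zero =>
    simp only [pow_zero, Finset.mem_one, List.length_eq_zero_iff]
    constructor
    · rintro rfl; exact ⟨[], rfl, by simp, rfl⟩
    · rintro ⟨l, rfl, -, rfl⟩; rfl
  | succ n ih =>
    rw [pow_succ', Finset.mem_mul]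
    constructor
    · rintro ⟨s, hs, y, hy, rfl⟩
      obtain ⟨l, rfl, hl, rfl⟩ := ih.1 hy
      exact ⟨s :: l, rfl, by simpa using ⟨hs, hl⟩, by simp⟩
    · rintro ⟨l, hlen, hl, rfl⟩
      obtain ⟨s, t, rfl⟩ := List.exists_of_length_succ l hlen
      simp only [List.mem_cons, forall_eq_or_imp] at hl
      exact ⟨s, hl.1, t.prod, ih.2 ⟨t, by simpa using hlen, hl.2, rfl⟩, by simp⟩

theorem List.prod_mem_finset_pow [DecidableEq G] (h1 : 1 ∈ S) {l : List G} {n : ℕ}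
    (hlen : l.length ≤ n) (hl : ∀ x ∈ l, x ∈ S) : l.prod ∈ S ^ n :=
  Finset.pow_subset_pow_right h1 hlen (Finset.mem_pow_iff_exists_list.2 ⟨l, rfl, hl, rfl⟩)

theorem IsShortlexMin.prod_mem_sphere [DecidableEq G] {l : List G} (h : IsShortlexMin S l)
    (hl : 0 < l.length) : l.prod ∈ S ^ l.length \ S ^ (l.length - 1) := by
  refine Finset.mem_sdiff.2 ⟨Finset.mem_pow_iff_exists_list.2 ⟨l, rfl, h.1, rfl⟩, fun hmem => ?_⟩
  obtain ⟨l', hlen, hl', hp⟩ := Finset.mem_pow_iff_exists_list.1 hmem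
  exact h.2 l' hl' hp (List.Shortlex.of_length_lt (by lia))

/-- If there are few elements of word length `n`, then minimal words are periodic away from
their ends. -/
theorem IsShortlexMin.getElem?_add_factorial [DecidableEq G] {l : List G}
    (h : IsShortlexMin S l) {c n : ℕ} (hn : c + c.factorial ≤ n)
    (hc : (S ^ n \ S ^ (n - 1)).card ≤ c) {t : ℕ} (ht : t + c + n ≤ l.length) :
    l[t + c]? = l[t + c + c.factorial]? := by
  have hpos := c.factorial_pos
  have hlen : ∀ i ≤ c, ((l.drop (t + i)).take n).length = n := fun i hi => by
    simp only [List.length_take, List.length_drop]; lia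
  -- Pigeonhole: the c + 1 windows of length n starting at t, …, t + c have products in a sphere
  -- with at most c elements. Windows with equal products coincide as words, being minimal, so the
  -- word locally has period j - i ≤ c, which divides c!.
  obtain ⟨i, j, hij, hj, heq⟩ : ∃ i j, i < j ∧ j ≤ c ∧
      (l.drop (t + i)).take n = (l.drop (t + j)).take n := by
    obtain ⟨i, hi, j, hj, hij, heq⟩ := Finset.exists_ne_map_eq_of_card_lt_of_maps_to
      (s := Finset.range (c + 1)) (t := S ^ n \ S ^ (n - 1))
      (f := fun i => ((l.drop (t + i)).take n).prod) (by simpa using Nat.lt_succ_of_le hc)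
      (fun i hi => by
        have hi' := hlen i (by simpa [Nat.lt_succ_iff] using hi)
        have := (h.window (t + i) n).prod_mem_sphere (by lia)
        rwa [hi'] at this)
    have heq' := (h.window (t + i) n).eq_of_prod_eq (h.window (t + j) n) heq
    rw [Finset.mem_range] at hi hj
    rcases lt_or_gt_of_ne hij with hlt | hlt
    · exact ⟨i, j, hlt, by lia, heq'⟩
    · exact ⟨j, i, hlt, by lia, heq'.symm⟩
  have hshift : ∀ y < n, l[t + i + y]? = l[t + j + y]? := fun y hy => by
    have := congrArg (fun m : List G => m[y]?) heq
    simpa [List.getElem?_take, hy] using this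
  have hmul : ∀ m, m * (j - i) ≤ c.factorial → l[t + c]? = l[t + c + m * (j - i)]? := by
    intro m
    induction m with
    | zero => simp
    | succ m ih =>
      intro hm
      rw [Nat.succ_mul] at hm
      rw [ih (by lia), Nat.succ_mul]
      have := hshift (c - i + m * (j - i)) (by lia)
      rwa [show t + i + (c - i + m * (j - i)) = t + c + m * (j - i) by lia,
        show t + j + (c - i + m * (j - i)) = t + c + (m * (j - i) + (j - i)) by lia] at this
  obtain ⟨m, hm⟩ := Nat.dvd_factorial (m := j - i) (n := c) (by lia) (by lia)
  rw [hmul m (by rw [hm, mul_comm]), hm, mul_comm]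

/-- Strip the first P letters repeatedly: by periodicity, what remains begins with the same block
until only a short tail is left. -/
theorem List.exists_prod_eq_pow_mul {P n : ℕ} (hP : 0 < P) (l : List G)
    (hl : ∀ x, x + n ≤ l.length → l[x]? = l[x + P]?) :
    ∃ (k : ℕ) (w : List G), w.length ≤ n + P ∧ (∀ x ∈ w, x ∈ l) ∧
      l.prod = (l.take P).prod ^ k * w.prod := by
  induction hlen : l.length using Nat.strong_induction_on generalizing l with
  | _ N ih =>
    subst hlen
    by_cases hlt : l.length ≤ n + P
    · exact ⟨0, l, hlt, fun x hx => hx, by simp⟩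
    have hl' : ∀ x, x + n ≤ (l.drop P).length → (l.drop P)[x]? = (l.drop P)[x + P]? := by
      intro x hx
      rw [List.length_drop] at hx
      rw [List.getElem?_drop, List.getElem?_drop, show P + (x + P) = P + x + P by lia]
      exact hl _ (by lia)
    have htake : (l.drop P).take P = l.take P := by
      refine List.ext_getElem? fun x => ?_
      simp only [List.getElem?_take, List.getElem?_drop]
      split_ifs with hx
      · rw [add_comm, hl x (by lia)]
      · rfl
    obtain ⟨k, w, hw, hmem, hprod⟩ := ih (l.drop P).length
      (by rw [List.length_drop]; lia) (l.drop P) hl' rfl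
    refine ⟨k + 1, w, hw, fun x hx => List.mem_of_mem_drop (hmem x hx), ?_⟩
    conv_lhs => rw [← List.take_append_drop P l, List.prod_append, hprod, htake]
    rw [pow_succ', mul_assoc]

theorem exists_list_of_closure_eq_top (hS : IsSymmWithOne S)
    (hgen : Subgroup.closure (S : Set G) = ⊤) (g : G) :
    ∃ l : List G, (∀ x ∈ l, x ∈ S) ∧ l.prod = g := by
  have hg : g ∈ Subgroup.closure (S : Set G) := hgen ▸ Subgroup.mem_top g
  induction hg using Subgroup.closure_induction with
  | mem x hx => exact ⟨[x], by simpa using hx, by simp⟩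
  | one => exact ⟨[], by simp, rfl⟩
  | mul x y _ _ hx hy =>
    obtain ⟨l, hl, rfl⟩ := hx
    obtain ⟨l', hl', rfl⟩ := hy
    exact ⟨l ++ l', fun z hz => (List.mem_append.1 hz).elim (hl z) (hl' z), by simp⟩
  | inv x _ hx =>
    obtain ⟨l, hl, rfl⟩ := hx
    refine ⟨(l.map (·⁻¹)).reverse, fun z hz => ?_, (List.prod_inv_reverse l).symm⟩
    obtain ⟨y, hy, rfl⟩ := List.mem_map.1 (List.mem_reverse.1 hz)
    exact hS.2 y (hl y hy)

/-- A group with few elements of some large enough word length is virtually cyclic. -/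
theorem isVirtuallyCyclic_of_card_sphere_le [DecidableEq G] (hS : IsSymmWithOne S)
    (hgen : Subgroup.closure (S : Set G) = ⊤) {c n : ℕ} (hn : c + c.factorial ≤ n)
    (hc : (S ^ n \ S ^ (n - 1)).card ≤ c) : IsVirtuallyCyclic G := by
  -- A minimal word factors as u b^k w = (u w)(w⁻¹ b w)^k with u, b, w in fixed finite balls. Thus
  -- finitely many left cosets of cyclic subgroups cover G, and B. H. Neumann's lemma applies.
  obtain ⟨p, -, hp⟩ := Subgroup.exists_finiteIndex_of_leftCoset_cover
    (s := (S ^ c) ×ˢ (S ^ c.factorial) ×ˢ (S ^ (n + c.factorial)))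
    (H := fun p : G × G × G => Subgroup.zpowers (p.2.2⁻¹ * p.2.1 * p.2.2))
    (g := fun p => p.1 * p.2.2) (by
      refine Set.eq_univ_of_forall fun g => ?_
      obtain ⟨l₀, hl₀, rfl⟩ := exists_list_of_closure_eq_top hS hgen g
      obtain ⟨l, hl, hp⟩ := exists_isShortlexMin hl₀
      obtain ⟨k, w, hw, hmem, hprod⟩ := List.exists_prod_eq_pow_mul (n := n) c.factorial_pos
        (l.drop c) (fun x hx => by
          rw [List.length_drop] at hx
          have := c.factorial_pos
          rw [List.getElem?_drop, List.getElem?_drop, ← add_assoc, add_comm c x]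
          exact hl.getElem?_add_factorial hn hc (by lia))
      simp only [Set.mem_iUnion]
      refine ⟨((l.take c).prod, ((l.drop c).take c.factorial).prod, w.prod), ?_, ?_⟩
      · simp only [Finset.mem_product]
        refine ⟨List.prod_mem_finset_pow hS.1 (List.length_take_le _ _) fun x hx =>
          hl.1 x (List.mem_of_mem_take hx), List.prod_mem_finset_pow hS.1
          (List.length_take_le _ _) fun x hx =>
            hl.1 x (List.mem_of_mem_drop (List.mem_of_mem_take hx)),
          List.prod_mem_finset_pow hS.1 hw fun x hx =>
            hl.1 x (List.mem_of_mem_drop (hmem x hx))⟩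
      · rw [Set.mem_smul_set_iff_inv_smul_mem]
        refine ⟨k, ?_⟩
        dsimp only
        have hfact : l₀.prod = (l.take c).prod *
            (((l.drop c).take c.factorial).prod ^ k * w.prod) := by
          rw [← hp, ← hprod, ← List.prod_append, List.take_append_drop]
        rw [hfact, zpow_natCast]
        have := conj_pow (i := k) (a := w.prod⁻¹) (b := ((l.drop c).take c.factorial).prod)
        rw [inv_inv] at this
        rw [this, smul_eq_mul]
        group)
  exact ⟨_, hp, inferInstance⟩

/-- A finitely generated group that is not virtually cyclic has superlinear growth. -/
theorem exists_mul_le_card_pow [DecidableEq G] (hS : IsSymmWithOne S)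
    (hgen : Subgroup.closure (S : Set G) = ⊤) (hG : ¬ IsVirtuallyCyclic G) (K : ℕ) :
    ∃ r, 1 ≤ r ∧ K * r ≤ (S ^ r).card := by
  -- From radius N on, each sphere has more than c elements, so the ball of radius 2N has at least c
  -- N = K (2N).
  set c := 2 * K
  set N := c + c.factorial
  have hN : 1 ≤ N := le_add_left c.factorial_pos
  have hsphere : ∀ n, N ≤ n → c < (S ^ n \ S ^ (n - 1)).card := fun n hn => by
    by_contra! h
    exact hG (isVirtuallyCyclic_of_card_sphere_le hS hgen hn h)
  have hball : ∀ m, c * m ≤ (S ^ (N + m)).card := fun m => by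
    induction m with
    | zero => simp
    | succ m ih =>
      have h1 := hsphere (N + (m + 1)) (by lia)
      rw [show N + (m + 1) - 1 = N + m by lia] at h1
      have h2 := Finset.card_sdiff_add_card_eq_card
        (Finset.pow_subset_pow_right hS.1 (show N + m ≤ N + (m + 1) by lia))
      rw [mul_add, mul_one]
      lia
  refine ⟨N + N, by lia, le_trans (le_of_eq ?_) (hball N)⟩
  ring

end Words

/-! ### Shrinking from superlinear growth -/

/-- This selects measurably a single route per net point, so that the measure of all routes carries
no factor counting the possible routes. -/
theorem exists_disjoint_measurable_refinement {ι X : Type*} [MeasurableSpace X] (F : Finset ι)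
    {A : ι → Set X} (hA : ∀ i, MeasurableSet (A i)) :
    ∃ B : ι → Set X, (∀ i, MeasurableSet (B i)) ∧ (∀ i, B i ⊆ A i) ∧
      (F : Set ι).PairwiseDisjoint B ∧ ∀ x, ∀ i ∈ F, x ∈ A i → ∃ j ∈ F, x ∈ B j := by
  classical
  induction F using Finset.induction_on with
  | empty => exact ⟨A, hA, fun i => subset_rfl, by simp, by simp⟩
  | insert a F ha ih =>
    obtain ⟨B, hBm, hBA, hd, hcov⟩ := ih
    have hne : ∀ i ∈ F, i ≠ a := fun i hi h => ha (h ▸ hi)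
    refine ⟨Function.update B a (A a \ ⋃ i ∈ F, B i), fun i => ?_, fun i => ?_, ?_,
      fun x i hi hx => ?_⟩
    · rcases eq_or_ne i a with rfl | h
      · rw [Function.update_self]
        exact (hA i).diff (Finset.measurableSet_biUnion _ fun j _ => hBm j)
      · rw [Function.update_of_ne h]; exact hBm i
    · rcases eq_or_ne i a with rfl | h
      · rw [Function.update_self]; exact Set.sdiff_subset
      · rw [Function.update_of_ne h]; exact hBA i
    · rw [Finset.coe_insert, Set.pairwiseDisjoint_insert_of_notMem (by simpa using ha)]
      refine ⟨fun i hi j hj hij => ?_, fun j hj => ?_⟩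
      · rw [Function.onFun, Function.update_of_ne (hne i hi), Function.update_of_ne (hne j hj)]
        exact hd hi hj hij
      · rw [Function.update_self, Function.update_of_ne (hne j hj)]
        exact Set.disjoint_left.2 fun x hx hxj =>
          hx.2 (Set.mem_biUnion (Finset.mem_coe.2 hj) hxj)
    · by_cases hxF : ∃ j ∈ F, x ∈ B j
      · obtain ⟨j, hj, hxj⟩ := hxF
        exact ⟨j, Finset.mem_insert_of_mem hj, by rwa [Function.update_of_ne (hne j hj)]⟩
      · rcases Finset.mem_insert.1 hi with rfl | hi
        · refine ⟨i, Finset.mem_insert_self i F, ?_⟩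
          rw [Function.update_self]
          refine ⟨hx, fun h => hxF ?_⟩
          simpa using h
        · exact absurd (hcov x i hi hx) hxF

theorem exists_prefixes_of_mem_pow {G : Type*} [Group G] [DecidableEq G] {S : Finset G} {n : ℕ}
    {g : G} (hg : g ∈ S ^ n) :
    ∃ p : ℕ → G, p 0 = 1 ∧ p n = g ∧ ∀ i < n, ∃ s ∈ S, p (i + 1) = s * p i := by
  induction n generalizing g with
  | zero => exact ⟨fun _ => 1, rfl, by simpa [eq_comm] using hg, by simp⟩
  | succ n ih =>
    rw [pow_succ', Finset.mem_mul] at hg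
    obtain ⟨s, hs, h, hh, rfl⟩ := hg
    obtain ⟨p, h0, hn, hp⟩ := ih hh
    refine ⟨fun i => if i ≤ n then p i else s * h, by simp [h0], by simp, fun i hi => ?_⟩
    rcases Nat.lt_succ_iff_lt_or_eq.1 hi with hi | rfl
    · simpa [hi.le, Nat.succ_le_of_lt hi] using hp i hi
    · exact ⟨s, hs, by simp [hn]⟩

theorem IsSymmWithOne.pow {G : Type*} [Group G] [DecidableEq G] {S : Finset G}
    (hS : IsSymmWithOne S) (n : ℕ) : IsSymmWithOne (S ^ n) := by
  refine ⟨Finset.one_mem_pow hS.1, fun g hg => ?_⟩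
  have hinv : S⁻¹ = S := by
    ext g
    rw [Finset.mem_inv']
    exact ⟨fun h => by simpa using hS.2 _ h, hS.2 g⟩
  have : (S ^ n)⁻¹ = S ^ n := by rw [← inv_pow, hinv]
  rw [← this]
  exact Finset.inv_mem_inv hg

theorem IsFreePMP.card_mul_measureReal_le_one {G : Type*} [Group G] {X : Type*}
    [MeasurableSpace X] [MulAction G X] {μ : Measure X} (h : IsFreePMP G μ) {F E : Finset G}
    {Y : Set X} (hY : MeasurableSet Y) (hind : ∀ y ∈ Y, ∀ f ∈ F, f • y ∈ Y → f • y = y)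
    (hE : ∀ f ∈ E, ∀ g ∈ E, g⁻¹ * f ∈ F) : (E.card : ℝ) * μ.real Y ≤ 1 := by
  have := ENNReal.toReal_mono ENNReal.one_ne_top (h.card_mul_measure_le_one hY hind hE)
  simpa [ENNReal.toReal_mul, Measure.real] using this

theorem IsFreePMP.measureReal_smul {G : Type*} [Group G] {X : Type*} [MeasurableSpace X]
    [MulAction G X] {μ : Measure X} (h : IsFreePMP G μ) (g : G) {A : Set X}
    (hA : MeasurableSet A) : μ.real (g • A) = μ.real A :=
  congrArg ENNReal.toReal (h.measure_smul g hA)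

/-- The set of points from which `W` is reached by a word of length `k`. -/
def wordNhd {G : Type*} [Group G] [DecidableEq G] {X : Type*} [MulAction G X] (S : Finset G)
    (W : Set X) (k : ℕ) : Set X :=
  {x | ∃ γ ∈ S ^ k, γ • x ∈ W}

section Superlinear

variable {G : Type*} [Group G] [DecidableEq G] {X : Type*} [MulAction G X] {S : Finset G}

theorem wordNhd_zero {W : Set X} : wordNhd S W 0 = W := by
  ext x; simp [wordNhd]

/-- Walk R + 1 steps towards `W`, then at most R steps to a net point: the net gain is at least one.
If the distance is at most R + 1, go straight to `W`. -/
theorem exists_step_to_wordNhd (hS : IsSymmWithOne S) {Y W : Set X} {R k : ℕ}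
    (hY : ∀ x, ∃ f ∈ S ^ R, f • x ∈ Y) {y : X} (hy : y ∈ wordNhd S W (k + 1)) :
    ∃ γ ∈ S ^ (2 * R + 1), γ • y ∈ W ∨ (γ • y ∈ Y ∧ γ • y ∈ wordNhd S W k) := by
  obtain ⟨γ, hγ, hγy⟩ := hy
  rcases le_or_gt k R with hk | hk
  · exact ⟨γ, Finset.pow_subset_pow_right hS.1 (by lia) hγ, Or.inl hγy⟩
  · rw [show k + 1 = (k - R) + (R + 1) by lia, pow_add, Finset.mem_mul] at hγ
    obtain ⟨γ₁, h₁, γ₂, h₂, rfl⟩ := hγ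
    obtain ⟨f, hf, hfY⟩ := hY (γ₂ • y)
    refine ⟨f * γ₂, ?_, Or.inr ⟨by rwa [mul_smul], γ₁ * f⁻¹, ?_, ?_⟩⟩
    · rw [show 2 * R + 1 = R + (R + 1) by lia, pow_add]
      exact Finset.mul_mem_mul hf h₂
    · have := Finset.mul_mem_mul h₁ ((hS.pow R).2 f hf)
      rwa [← pow_add, show k - R + R = k by lia] at this
    · rwa [← mul_smul, show γ₁ * f⁻¹ * (f * γ₂) = γ₁ * γ₂ by group]

/-- Connecting each point of a net `Y` to a point of the net closer to the sparse set `W`. -/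
theorem exists_connected_to_sparse [MeasurableSpace X] {μ : Measure X} (h : IsFreePMP G μ)
    (hS : IsSymmWithOne S) {Y W : Set X} (hYm : MeasurableSet Y) (hWm : MeasurableSet W)
    {R D : ℕ} (hY : ∀ x, ∃ f ∈ S ^ R, f • x ∈ Y) (hW : ∀ x, ∃ f ∈ S ^ D, f • x ∈ W) :
    ∃ V : Set X, MeasurableSet V ∧ W ⊆ V ∧ Y ⊆ V ∧
      μ.real V ≤ μ.real W + (2 * R + 2) * μ.real Y ∧
      V ⊆ reachSet S V W (D * (2 * R + 1) + (2 * R + 1)) := by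
  have := h.isProbabilityMeasure
  set M := 2 * R + 1
  have hpre : ∀ (g : G) {B : Set X}, MeasurableSet B → MeasurableSet {x | g • x ∈ B} :=
    fun g B hB => h.measurable_smul g hB
  have hNm : ∀ k, MeasurableSet (wordNhd S W k) := fun k => by
    have : wordNhd S W k = ⋃ γ ∈ S ^ k, {x | γ • x ∈ W} := by ext; simp [wordNhd]
    rw [this]
    exact Finset.measurableSet_biUnion _ fun γ _ => hpre γ hWm
  -- Net points that γ sends into `W`, or to a net point strictly closer to `W` in word distance.
  let A : G → Set X := fun γ => Y ∩ ({x | γ • x ∈ W} ∪ ({x | γ • x ∈ Y} ∩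
    ⋃ k, {x | γ • x ∈ wordNhd S W k} ∩ ⋂ j ∈ Finset.range (k + 1), (wordNhd S W j)ᶜ))
  have hAm : ∀ γ, MeasurableSet (A γ) := fun γ =>
    hYm.inter ((hpre γ hWm).union ((hpre γ hYm).inter (MeasurableSet.iUnion fun k =>
      (hpre γ (hNm k)).inter (Finset.measurableSet_biInter _ fun j _ => (hNm j).compl))))
  have hAcov : ∀ y ∈ Y, ∃ γ ∈ S ^ M, y ∈ A γ := fun y hy => by
    classical
    have hex : ∃ k, y ∈ wordNhd S W k := ⟨D, hW y⟩
    rcases hk : Nat.find hex with _ | k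
    · have h0 := Nat.find_spec hex
      rw [hk, wordNhd_zero] at h0
      exact ⟨1, Finset.one_mem_pow hS.1, hy, Or.inl (by simpa using h0)⟩
    · have h0 := Nat.find_spec hex
      rw [hk] at h0
      obtain ⟨γ, hγ, hγy⟩ := exists_step_to_wordNhd hS hY h0
      refine ⟨γ, hγ, hy, hγy.imp id fun h' => ⟨h'.1, Set.mem_iUnion.2 ⟨k, h'.2, ?_⟩⟩⟩
      simp only [Set.mem_iInter, Finset.mem_range]
      exact fun j hj => Nat.find_min hex (by lia)
  obtain ⟨B, hBm, hBA, hBd, hBcov⟩ := exists_disjoint_measurable_refinement (S ^ M) hAm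
  choose! p hp0 hpM hps using fun (γ : G) (hγ : γ ∈ S ^ M) => exists_prefixes_of_mem_pow hγ
  set V : Set X := W ∪ ⋃ γ ∈ S ^ M, ⋃ i ∈ Finset.range (M + 1), p γ i • B γ with hV
  have hWV : W ⊆ V := Set.subset_union_left
  have hpV : ∀ γ ∈ S ^ M, ∀ i ≤ M, ∀ y ∈ B γ, p γ i • y ∈ V := fun γ hγ i hi y hy =>
    Or.inr (Set.mem_biUnion (Finset.mem_coe.2 hγ)
      (Set.mem_biUnion (x := i) (by simpa [Nat.lt_succ_iff] using hi)
        (Set.smul_mem_smul_set hy)))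
  have hcovB : ∀ y ∈ Y, ∃ γ ∈ S ^ M, y ∈ B γ := fun y hy => by
    obtain ⟨γ, hγ, hyA⟩ := hAcov y hy
    exact hBcov y γ hγ hyA
  have hYV : Y ⊆ V := fun y hy => by
    obtain ⟨γ, hγ, hyB⟩ := hcovB y hy
    have := hpV γ hγ 0 (Nat.zero_le _) y hyB
    rwa [hp0 γ hγ, one_smul] at this
  have hpath : ∀ n, ∀ γ ∈ S ^ M, ∀ y ∈ B γ, γ • y ∈ reachSet S V W n → ∀ i ≤ M,
      p γ i • y ∈ reachSet S V W (n + M) := by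
    intro n γ hγ y hy hreach i hi
    refine reachSet_mono hS.1 (show n + (M - i) ≤ n + M by lia) ?_
    refine mem_reachSet_of_path (q := fun j => p γ (i + j) • y) (fun j hj => ?_)
      (fun j hj => hpV γ hγ _ (by lia) y hy) ?_
    · obtain ⟨s, hs, hs'⟩ := hps γ hγ (i + j) (by lia)
      exact ⟨s, hs, by rw [← add_assoc, hs', mul_smul]⟩
    · rwa [Nat.add_sub_cancel' hi, hpM γ hγ]
  -- Induction on the distance to `W`, which drops along each route of length `M`; this bounds the
  -- path length uniformly over all actions.
  have hnext : ∀ k, ∀ y ∈ Y, y ∈ wordNhd S W k → ∀ γ ∈ S ^ M, y ∈ B γ →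
      γ • y ∈ reachSet S V W (k * M) := by
    intro k
    induction k using Nat.strong_induction_on with
    | _ k ih =>
      intro y hy hyk γ hγ hyB
      rcases (hBA γ hyB).2 with hW' | ⟨hY', hk'⟩
      · exact reachSet_mono hS.1 (Nat.zero_le _) ⟨hW', hWV hW'⟩
      · obtain ⟨j, hj, hj'⟩ := Set.mem_iUnion.1 hk'
        have hjk : j < k := by
          by_contra! hle
          simp only [Set.mem_iInter, Finset.mem_range] at hj'
          exact hj' k (by lia) hyk
        obtain ⟨γ', hγ', hyB'⟩ := hcovB _ hY'
        have h1 := hpath _ γ' hγ' _ hyB' (ih j hjk _ hY' hj γ' hγ' hyB') 0 (Nat.zero_le _)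
        rw [hp0 γ' hγ', one_smul] at h1
        refine reachSet_mono hS.1 ?_ h1
        rw [← Nat.succ_mul]
        exact Nat.mul_le_mul_right _ hjk
  refine ⟨V, hWm.union (Finset.measurableSet_biUnion _ fun γ _ =>
    Finset.measurableSet_biUnion _ fun i _ => h.measurableSet_smul _ (hBm γ)), hWV, hYV, ?_,
    fun x hx => ?_⟩
  · have hsum : ∑ γ ∈ S ^ M, μ.real (B γ) ≤ μ.real Y := by
      rw [← measureReal_biUnion_finset hBd fun γ _ => hBm γ]
      exact measureReal_mono (Set.iUnion₂_subset fun γ _ x hx => (hBA γ hx).1)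
    calc μ.real V ≤ μ.real W + μ.real (⋃ γ ∈ S ^ M, ⋃ i ∈ Finset.range (M + 1), p γ i • B γ) :=
          measureReal_union_le _ _
      _ ≤ μ.real W + ∑ γ ∈ S ^ M, ∑ i ∈ Finset.range (M + 1), μ.real (p γ i • B γ) := by
          gcongr
          exact (measureReal_biUnion_finset_le _ _).trans
            (Finset.sum_le_sum fun γ _ => measureReal_biUnion_finset_le _ _)
      _ = μ.real W + (2 * R + 2) * ∑ γ ∈ S ^ M, μ.real (B γ) := by
          simp only [h.measureReal_smul _ (hBm _), Finset.sum_const, Finset.card_range,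
            nsmul_eq_mul, Finset.mul_sum, M]
          push_cast
          ring_nf
      _ ≤ _ := by gcongr
  · rcases hx with hx | hx
    · exact reachSet_mono hS.1 (Nat.zero_le _) ⟨hx, hWV hx⟩
    · simp only [Set.mem_iUnion, Finset.mem_range] at hx
      obtain ⟨γ, hγ, i, hi, y, hy, rfl⟩ := hx
      exact hpath _ γ hγ y hy (hnext D y (hBA γ hy).1 (hW y) γ hγ hy) i (by lia)

end Superlinear

/-- Independence for the ball of radius 2r gives μ(Y) ≤ 1/|S^r| ≤ 1/(K r), while each net point pays
for 4r + 2 ≤ 6r path points. With K > 12/ε the routes cost at most ε/2. -/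
theorem hasShrinkingProperty_of_superlinear_growth {G : Type u} [Group G] [DecidableEq G]
    {S : Finset G} (hS : IsSymmWithOne S)
    (hgrowth : ∀ K : ℕ, ∃ r, 1 ≤ r ∧ K * r ≤ (S ^ r).card) :
    HasShrinkingProperty.{u, v} G := by
  have hsub : ∀ r, ∀ f ∈ S ^ r, ∀ g ∈ S ^ r, g⁻¹ * f ∈ S ^ (2 * r) := fun r f hf g hg => by
    rw [two_mul, pow_add]
    exact Finset.mul_mem_mul ((hS.pow r).2 g hg) hf
  refine ⟨S, hS, fun ε hε => ?_⟩
  obtain ⟨K, hK⟩ := exists_nat_gt (12 / ε)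
  obtain ⟨r, hr, hKr⟩ := hgrowth K
  refine ⟨S ^ (2 * r), hS.pow _, fun δ hδ => ?_⟩
  -- δ affects only the sparse set `W` and the path length; the net, hence the covering set `S ^ (2
  -- * r)`, is already fixed.
  obtain ⟨L, hL⟩ := exists_nat_gt (1 / min (ε / 2) δ)
  obtain ⟨d, hd, hLd⟩ := hgrowth L
  refine ⟨2 * d * (2 * (2 * r) + 1) + (2 * (2 * r) + 1), fun X _ _ _ μ hμ => ?_⟩
  have := hμ.isProbabilityMeasure
  obtain ⟨Y, hYm, hYi, hYc⟩ :=
    exists_measurableSet_maximal_independent (X := X) hμ.measurable_smul (hS.pow (2 * r))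
  obtain ⟨W, hWm, hWi, hWc⟩ :=
    exists_measurableSet_maximal_independent (X := X) hμ.measurable_smul (hS.pow (2 * d))
  obtain ⟨V, hVm, hWV, hYV, hVμ, hVr⟩ := exists_connected_to_sparse hμ hS hYm hWm hYc hWc
  have hYμ := hμ.card_mul_measureReal_le_one hYm hYi (hsub r)
  have hWμ := hμ.card_mul_measureReal_le_one hWm hWi (hsub d)
  have hY' : (K * r : ℝ) * μ.real Y ≤ 1 :=
    (mul_le_mul_of_nonneg_right (by exact_mod_cast hKr) measureReal_nonneg).trans hYμ
  have hW' : (L : ℝ) * μ.real W ≤ 1 := by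
    refine (mul_le_mul_of_nonneg_right ?_ measureReal_nonneg).trans hWμ
    exact_mod_cast (Nat.le_mul_of_pos_right L hd).trans hLd
  have hm : 0 < min (ε / 2) δ := lt_min (half_pos hε) hδ
  have hW2 : μ.real W ≤ min (ε / 2) δ := by
    rw [div_lt_iff₀ hm] at hL
    by_contra! hlt
    have hL0 : (0 : ℝ) < L := by
      by_contra! h0
      nlinarith
    nlinarith
  have hY2 : (2 * ((2 * r : ℕ) : ℝ) + 2) * μ.real Y ≤ ε / 2 := by
    have hr' : (1 : ℝ) ≤ r := by exact_mod_cast hr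
    have hy0 : 0 ≤ μ.real Y := measureReal_nonneg
    have h1 : (2 * ((2 * r : ℕ) : ℝ) + 2) * μ.real Y ≤ 6 * (r * μ.real Y) := by
      push_cast
      nlinarith
    rw [div_lt_iff₀ hε] at hK
    have h2 : 12 * (r * μ.real Y) ≤ ε := by
      have h0 : 0 ≤ r * μ.real Y := by positivity
      calc 12 * (r * μ.real Y) ≤ K * ε * (r * μ.real Y) := by gcongr
        _ = ε * (K * r * μ.real Y) := by ring
        _ ≤ ε * 1 := by gcongr
        _ = ε := mul_one ε
    linarith
  refine ⟨W, V, hWm, hVm, hWV, Set.eq_univ_of_forall fun x => ?_, ?_, ?_, fun x hx => ?_⟩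
  · obtain ⟨f, hf, hfx⟩ := hYc x
    exact Set.mem_smul.2 ⟨f⁻¹, (hS.pow _).2 f hf, f • x, hYV hfx, inv_smul_smul f x⟩
  · rw [ENNReal.le_ofReal_iff_toReal_le (measure_ne_top _ _) hε.le]
    have := hW2.trans (min_le_left _ _)
    exact hVμ.trans (by linarith)
  · rw [ENNReal.le_ofReal_iff_toReal_le (measure_ne_top _ _) hδ.le]
    exact hW2.trans (min_le_right _ _)
  · exact ⟨_, le_rfl, exists_isActionPath_of_mem_reachSet (hVr hx)⟩

/-! ### Shrinking along an infinite cyclic subgroup with commensurating translates -/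

/-- Take Y maximal independent for the boxes {a^k t_i : k < N, i < m} and V the segments a^[-N,N] Y.
The boxes have N m elements, so μ(V) ≤ (2N+1)/(N m) ≤ 3/m, whatever N is. -/
theorem hasShrinkingProperty_of_commensurated_zpowers {G : Type u} [Group G] {a : G}
    (ha : ¬ IsOfFinOrder a)
    (h : ∀ m : ℕ, ∃ t : Fin m → G, (∀ i j (k : ℤ), a ^ k * t i = t j → i = j) ∧
      ∃ q : ℕ, 0 < q ∧ ∀ i, SemiconjBy (t i) (a ^ q) (a ^ q) ∨
        SemiconjBy (t i) (a ^ q) (a ^ q)⁻¹) :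
    HasShrinkingProperty.{u, v} G := by
  classical
  have hinj : Function.Injective fun k : ℤ => a ^ k := injective_zpow_iff_not_isOfFinOrder.2 ha
  refine ⟨{1, a, a⁻¹}, ⟨by simp, by simp⟩, fun ε hε => ?_⟩
  obtain ⟨m, hm⟩ := exists_nat_gt (3 / ε)
  have hm0 : 0 < m := by
    have : (0 : ℝ) < m := (by positivity : 0 < 3 / ε).trans hm
    exact_mod_cast this
  obtain ⟨t, ht, q, hq, hconj⟩ := h m
  set S₀ : Finset G := Finset.univ.image fun p : Fin m × Fin m × Fin q =>
    (t p.1)⁻¹ * a ^ (p.2.2 : ℕ) * t p.2.1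
  refine ⟨insert 1 (S₀ ∪ S₀⁻¹), ⟨by simp, fun g hg => ?_⟩, fun δ hδ => ?_⟩
  · simp only [Finset.mem_insert, Finset.mem_union, Finset.mem_inv', inv_inv, inv_eq_one] at hg ⊢
    tauto
  obtain ⟨n, hn⟩ := exists_nat_gt (1 / δ)
  have hn0 : 0 < n := by
    have : (0 : ℝ) < n := (by positivity : 0 < 1 / δ).trans hn
    exact_mod_cast this
  -- Large n makes `Y` smaller than δ; as a multiple of q, `N` still bounds the exponent after
  -- rounding down to a multiple of q.
  set N := q * n
  have hN0 : 0 < N := Nat.mul_pos hq hn0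
  refine ⟨N, fun X _ _ _ μ hμ => ?_⟩
  have := hμ.isProbabilityMeasure
  set E : Finset G := Finset.univ.image fun p : Fin N × Fin m => a ^ (p.1 : ℕ) * t p.2 with hEdef
  have hEcard : E.card = N * m := by
    rw [hEdef, Finset.card_image_of_injective, Finset.card_univ]
    · simp
    · rintro ⟨k, i⟩ ⟨l, j⟩ heq
      dsimp only at heq
      have h1 : a ^ ((k : ℤ) - (l : ℤ)) * t i = t j := by
        rw [sub_eq_neg_add, zpow_add, zpow_natCast, mul_assoc, heq, zpow_neg, zpow_natCast,
          inv_mul_cancel_left]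
      obtain rfl := ht i j _ h1
      have h2 : a ^ (k : ℤ) = a ^ (l : ℤ) := by simpa using heq
      have h3 : (k : ℤ) = l := hinj h2
      exact Prod.ext (Fin.ext (by exact_mod_cast h3)) rfl
  set F : Finset G := E⁻¹ * E with hFdef
  have hEF : ∀ f ∈ E, ∀ g ∈ E, g⁻¹ * f ∈ F := fun f hf g hg =>
    Finset.mul_mem_mul (Finset.inv_mem_inv hg) hf
  have hEmem : ∀ k : Fin N, ∀ i, a ^ (k : ℕ) * t i ∈ E := fun k i =>
    Finset.mem_image_of_mem (fun p : Fin N × Fin m => a ^ (p.1 : ℕ) * t p.2)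
      (Finset.mem_univ (k, i))
  have hF : IsSymmWithOne F := by
    refine ⟨?_, fun g hg => ?_⟩
    · have h0 := hEmem ⟨0, hN0⟩ ⟨0, hm0⟩
      simpa using hEF _ h0 _ h0
    · have : F⁻¹ = F := by rw [hFdef, mul_inv_rev, inv_inv]
      rw [← this]
      exact Finset.inv_mem_inv hg
  obtain ⟨Y, hYm, hYi, hYc⟩ :=
    exists_measurableSet_maximal_independent (X := X) hμ.measurable_smul hF
  have hYμ := hμ.card_mul_measureReal_le_one hYm hYi hEF
  set V : Set X := ⋃ j ∈ Finset.Icc (-(N : ℤ)) N, a ^ j • Y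
  have hmemV : ∀ j : ℤ, -(N : ℤ) ≤ j → j ≤ N → ∀ y ∈ Y, a ^ j • y ∈ V := fun j h1 h2 y hy =>
    Set.mem_biUnion (Finset.mem_coe.2 (Finset.mem_Icc.2 ⟨h1, h2⟩)) (Set.smul_mem_smul_set hy)
  have hYV : Y ⊆ V := fun y hy => by simpa using hmemV 0 (by lia) (by lia) y hy
  have hVm : MeasurableSet V :=
    Finset.measurableSet_biUnion _ fun j _ => hμ.measurableSet_smul _ hYm
  have hreach : ∀ k : ℕ, k ≤ N → ∀ y ∈ Y,
      a ^ (k : ℤ) • y ∈ reachSet {1, a, a⁻¹} V Y k ∧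
      a ^ (-(k : ℤ)) • y ∈ reachSet {1, a, a⁻¹} V Y k := by
    intro k hk y hy
    induction k with
    | zero => simpa [reachSet] using ⟨hy, hYV hy⟩
    | succ k ih =>
      obtain ⟨h1, h2⟩ := ih (by lia)
      refine ⟨⟨hmemV _ (by lia) (by lia) y hy, a⁻¹, by simp, ?_⟩,
        ⟨hmemV _ (by lia) (by lia) y hy, a, by simp, ?_⟩⟩
      · rw [← mul_smul]
        convert h1 using 2
        rw [Nat.cast_succ, add_comm, zpow_add, zpow_one, inv_mul_cancel_left]
      · rw [← mul_smul]
        convert h2 using 2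
        rw [← zpow_one_add]
        congr 1
        push_cast
        ring
  have hVμ : μ.real V ≤ (2 * N + 1) * μ.real Y := by
    refine (measureReal_biUnion_finset_le _ _).trans (le_of_eq ?_)
    simp only [hμ.measureReal_smul _ hYm, Finset.sum_const, Int.card_Icc, nsmul_eq_mul]
    congr 1
    rw [show ((N : ℤ) + 1 - -(N : ℤ)).toNat = 2 * N + 1 by lia]
    push_cast
    ring
  have hy0 : 0 ≤ μ.real Y := measureReal_nonneg
  have hN1 : (1 : ℝ) ≤ N := by exact_mod_cast hN0
  have hNY : (N : ℝ) * μ.real Y * m ≤ 1 := by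
    rw [hEcard] at hYμ
    push_cast at hYμ
    linarith
  have hNY0 : 0 ≤ (N : ℝ) * μ.real Y := by positivity
  refine ⟨Y, V, hYm, hVm, hYV, Set.eq_univ_of_forall fun x => ?_, ?_, ?_, fun x hx => ?_⟩
  · obtain ⟨f, hf, hfx⟩ := hYc x
    rw [← inv_smul_smul f x]
    generalize f • x = y at hfx
    obtain ⟨_, hg, _, hg', rfl⟩ := Finset.mem_mul.1 hf
    obtain ⟨⟨k, i⟩, -, hk⟩ := Finset.mem_image.1 (Finset.mem_inv'.1 hg)
    obtain ⟨⟨l, j⟩, -, rfl⟩ := Finset.mem_image.1 hg'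
    obtain rfl := inv_eq_iff_eq_inv.1 hk.symm
    have hq' : (q : ℤ) ≠ 0 := by exact_mod_cast hq.ne'
    have hr0 := Int.emod_nonneg ((k : ℤ) - l) hq'
    have hrq := Int.emod_lt_of_pos ((k : ℤ) - l) (by exact_mod_cast hq : (0 : ℤ) < q)
    have hdiv := Int.mul_ediv_add_emod ((k : ℤ) - l) q
    set d := ((k : ℤ) - l) / q
    obtain ⟨r, hr⟩ := Int.eq_ofNat_of_zero_le hr0
    rw [hr] at hdiv hrq
    have hkN : (k : ℤ) < N := by exact_mod_cast k.2
    have hlN : (l : ℤ) < N := by exact_mod_cast l.2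
    have hNq : (N : ℤ) = q * n := by simp [N]
    have hdn : -(n : ℤ) ≤ d ∧ d ≤ n := by
      constructor <;> by_contra! hlt <;> nlinarith
    obtain ⟨e, he, hcomm⟩ : ∃ e : ℤ, (e = d ∨ e = -d) ∧
        (a ^ q) ^ d * t i = t i * (a ^ q) ^ e := by
      rcases hconj i with hc | hc
      · exact ⟨d, Or.inl rfl, ((hc.zpow_right d).eq).symm⟩
      · refine ⟨-d, Or.inr rfl, ?_⟩
        have := (hc.zpow_right (-d)).eq
        rw [this, inv_zpow, zpow_neg, inv_inv]
    -- With k - l = q d + r, moving a^(q d) past t_i only changes its sign. What is left on the left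
    -- lies in `S₀`, which does not depend on δ, and the power of a moves along the segment.
    have hprod : ((a ^ (k : ℕ) * t i)⁻¹ * (a ^ (l : ℕ) * t j))⁻¹ =
        (t j)⁻¹ * a ^ r * t i * a ^ ((q : ℤ) * e) := by
      have hpow : a ^ ((k : ℤ) - l) = a ^ r * (a ^ q) ^ d := by
        rw [← hdiv, add_comm, zpow_add, zpow_mul, zpow_natCast, zpow_natCast]
      calc ((a ^ (k : ℕ) * t i)⁻¹ * (a ^ (l : ℕ) * t j))⁻¹
          = (t j)⁻¹ * a ^ ((k : ℤ) - l) * t i := by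
            rw [sub_eq_neg_add, zpow_add, zpow_neg, zpow_natCast, zpow_natCast]; group
        _ = (t j)⁻¹ * a ^ r * ((a ^ q) ^ d * t i) := by rw [hpow]; simp only [mul_assoc]
        _ = _ := by rw [hcomm, zpow_mul, zpow_natCast]; simp only [mul_assoc]
    have hqe : -(N : ℤ) ≤ q * e ∧ q * e ≤ N := by
      rw [hNq]
      have hqpos : (0 : ℤ) ≤ q := by positivity
      rcases he with rfl | rfl <;> constructor <;> nlinarith
    rw [hprod, mul_smul]
    refine Set.smul_mem_smul (Finset.mem_coe.2 (Finset.mem_insert_of_mem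
      (Finset.mem_union_left _ (Finset.mem_image.2 ⟨(j, i, ⟨r, by lia⟩), Finset.mem_univ _, rfl⟩))))
      (hmemV _ hqe.1 hqe.2 y hfx)
  · rw [ENNReal.le_ofReal_iff_toReal_le (measure_ne_top _ _) hε.le]
    refine hVμ.trans ?_
    rw [div_lt_iff₀ hε] at hm
    nlinarith
  · rw [ENNReal.le_ofReal_iff_toReal_le (measure_ne_top _ _) hδ.le]
    change μ.real Y ≤ δ
    rw [div_lt_iff₀ hδ] at hn
    have hm1 : (1 : ℝ) ≤ m := by exact_mod_cast hm0
    have hnN : (n : ℝ) ≤ N := by exact_mod_cast Nat.le_mul_of_pos_left n hq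
    have h1 : (n : ℝ) * μ.real Y ≤ 1 := by nlinarith
    nlinarith
  · simp only [V, Set.mem_iUnion, Finset.mem_Icc] at hx
    obtain ⟨j, ⟨hj1, hj2⟩, y, hy, rfl⟩ := hx
    refine ⟨j.natAbs, by lia, exists_isActionPath_of_mem_reachSet ?_⟩
    have hj := hreach j.natAbs (by lia) y hy
    rcases Int.natAbs_eq j with h' | h'
    · conv in a ^ j => rw [h']
      exact hj.1
    · conv in a ^ j => rw [h']
      exact hj.2

/-! ### Virtually cyclic subgroups and the case distinction -/

/-- The normal core of a finite-index cyclic subgroup is infinite cyclic, so conjugation by t fixes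
or inverts its generator; some positive power of a lies in it. -/
theorem exists_semiconjBy_pow_of_isVirtuallyCyclic {G : Type*} [Group G]
    (hG : IsVirtuallyCyclic G) {a : G} (ha : ¬ IsOfFinOrder a) (t : G) :
    ∃ q : ℕ, 0 < q ∧ (SemiconjBy t (a ^ q) (a ^ q) ∨ SemiconjBy t (a ^ q) (a ^ q)⁻¹) := by
  obtain ⟨H, hfin, hcyc⟩ := hG
  have hncyc : IsCyclic H.normalCore := Subgroup.isCyclic_of_le H.normalCore_le
  obtain ⟨c, hc⟩ := (Subgroup.isCyclic_iff_exists_zpowers_eq_top _).1 hncyc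
  have hmem : ∀ g, g ∈ H.normalCore ↔ ∃ k : ℤ, c ^ k = g := fun g => by
    rw [← hc]; exact Subgroup.mem_zpowers_iff
  obtain ⟨p, hp0, -, hp⟩ := Subgroup.exists_pow_mem_of_index_ne_zero
    (Subgroup.FiniteIndex.index_ne_zero (H := H.normalCore)) a
  obtain ⟨e, he⟩ := (hmem _).1 hp
  have hcinf : ¬ IsOfFinOrder c := fun h => ha <| by
    have : IsOfFinOrder (a ^ p) := he ▸ h.zpow
    exact (isOfFinOrder_pow.1 this).resolve_right hp0.ne'
  have hcmem : c ∈ H.normalCore := (hmem c).2 ⟨1, zpow_one c⟩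
  obtain ⟨k, hk⟩ := (hmem _).1 (Subgroup.Normal.conj_mem inferInstance c hcmem t)
  obtain ⟨l, hl⟩ := (hmem _).1 (Subgroup.Normal.conj_mem inferInstance c hcmem t⁻¹)
  have hkl : l * k = 1 := by
    apply injective_zpow_iff_not_isOfFinOrder.2 hcinf
    dsimp only
    rw [zpow_mul, hl, inv_inv, zpow_one]
    have := conj_zpow (i := k) (a := t⁻¹) (b := c)
    rw [inv_inv] at this
    rw [this, hk]
    group
  refine ⟨p, hp0, ?_⟩
  have hsc : SemiconjBy t c (c ^ k) := by
    rw [hk]; simp [SemiconjBy]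
  rw [← he]
  rcases Int.isUnit_iff.1 (IsUnit.of_mul_eq_one_right l hkl) with rfl | rfl
  · rw [zpow_one] at hsc
    exact Or.inl (hsc.zpow_right e)
  · rw [zpow_neg_one] at hsc
    rw [← inv_zpow]
    exact Or.inr (hsc.zpow_right e)

theorem exists_not_isOfFinOrder_of_isVirtuallyCyclic {G : Type*} [Group G] [Infinite G]
    (hG : IsVirtuallyCyclic G) : ∃ a : G, ¬ IsOfFinOrder a := by
  obtain ⟨H, hfin, hcyc⟩ := hG
  obtain ⟨c, hc⟩ := (Subgroup.isCyclic_iff_exists_zpowers_eq_top _).1 hcyc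
  refine ⟨c, fun h => ?_⟩
  have : Finite H := by
    rw [← hc]; exact finite_zpowers.2 h
  have hcard := H.card_mul_index
  rw [Nat.card_eq_zero_of_infinite (α := G), mul_eq_zero] at hcard
  exact hcard.elim Nat.card_pos.ne' hfin.index_ne_zero

theorem exists_distinct_cosets_of_not_isVirtuallyCyclic {G : Type*} [Group G]
    (hG : ¬ IsVirtuallyCyclic G) (a : G) (m : ℕ) :
    ∃ t : Fin m → G, ∀ i j (k : ℤ), a ^ k * t i = t j → i = j := by
  have hinf : Infinite (G ⧸ Subgroup.zpowers a) := by
    by_contra hfin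
    rw [not_infinite_iff_finite] at hfin
    exact hG ⟨Subgroup.zpowers a, Subgroup.finiteIndex_of_finite_quotient, inferInstance⟩
  refine ⟨fun i => (Infinite.natEmbedding (G ⧸ Subgroup.zpowers a) i).out⁻¹,
    fun i j k hk => ?_⟩
  dsimp only at hk
  have h1 : Infinite.natEmbedding (G ⧸ Subgroup.zpowers a) j =
      Infinite.natEmbedding (G ⧸ Subgroup.zpowers a) i := by
    rw [← QuotientGroup.out_eq' (Infinite.natEmbedding (G ⧸ Subgroup.zpowers a) j),
      ← QuotientGroup.out_eq' (Infinite.natEmbedding (G ⧸ Subgroup.zpowers a) i),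
      QuotientGroup.eq, ← hk]
    refine ⟨k, ?_⟩
    simp
  exact Fin.ext ((Infinite.natEmbedding _).injective h1).symm

theorem hasShrinkingProperty_of_not_isVirtuallyCyclic_of_fg {G : Type u} [Group G]
    (hfg : Group.FG G) (hG : ¬ IsVirtuallyCyclic G) : HasShrinkingProperty.{u, v} G := by
  classical
  obtain ⟨S, hS⟩ := Group.fg_def.1 hfg
  have hS' : IsSymmWithOne (insert 1 (S ∪ S⁻¹)) := ⟨by simp, fun g hg => by
    simp only [Finset.mem_insert, Finset.mem_union, Finset.mem_inv', inv_inv, inv_eq_one] at hg ⊢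
    tauto⟩
  refine hasShrinkingProperty_of_superlinear_growth hS' (exists_mul_le_card_pow hS' ?_ hG)
  rw [eq_top_iff, ← hS]
  exact Subgroup.closure_mono fun g hg => by
    simp only [Finset.coe_insert, Finset.coe_union]
    exact Or.inr (Or.inl hg)

theorem hasShrinkingProperty_of_not_locallyFinite_of_not_virtuallyCyclic {G : Type u} [Group G]
    (hlf : ¬ IsLocallyFiniteGroup G) (hvc : ¬ IsVirtuallyCyclic G) :
    HasShrinkingProperty.{u, v} G := by
  classical
  by_cases hloc : ∃ H : Subgroup G, H.FG ∧ ¬ IsVirtuallyCyclic H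
  · obtain ⟨H, hfg, hH⟩ := hloc
    exact .of_subgroup H (hasShrinkingProperty_of_not_isVirtuallyCyclic_of_fg
      ((Group.fg_iff_subgroup_fg H).2 hfg) hH)
  push Not at hloc
  obtain ⟨a, ha⟩ : ∃ a : G, ¬ IsOfFinOrder a := by
    simp only [IsLocallyFiniteGroup, not_forall] at hlf
    obtain ⟨H, hfg, hH⟩ := hlf
    rw [not_finite_iff_infinite] at hH
    obtain ⟨a, ha⟩ := exists_not_isOfFinOrder_of_isVirtuallyCyclic (hloc H hfg)
    exact ⟨a, by rwa [Submonoid.isOfFinOrder_coe]⟩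
  -- The subgroup generated by a and t is finitely generated, hence virtually cyclic in this case.
  have hsc : ∀ t : G, ∃ q : ℕ, 0 < q ∧
      (SemiconjBy t (a ^ q) (a ^ q) ∨ SemiconjBy t (a ^ q) (a ^ q)⁻¹) := fun t => by
    have hK : (Subgroup.closure ({a, t} : Set G)).FG := ⟨{a, t}, by simp⟩
    have haK : a ∈ Subgroup.closure ({a, t} : Set G) := Subgroup.subset_closure (by simp)
    have htK : t ∈ Subgroup.closure ({a, t} : Set G) := Subgroup.subset_closure (by simp)
    obtain ⟨q, hq, h⟩ := exists_semiconjBy_pow_of_isVirtuallyCyclic (hloc _ hK)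
      (a := ⟨a, haK⟩) (by rwa [← Submonoid.isOfFinOrder_coe]) ⟨t, htK⟩
    refine ⟨q, hq, h.imp (fun h => ?_) fun h => ?_⟩
    · exact congrArg Subtype.val h
    · exact congrArg Subtype.val h
  refine hasShrinkingProperty_of_commensurated_zpowers ha fun m => ?_
  obtain ⟨t, ht⟩ := exists_distinct_cosets_of_not_isVirtuallyCyclic hvc a m
  choose q hq hqt using fun i => hsc (t i)
  refine ⟨t, ht, ∏ i, q i, Finset.prod_pos fun i _ => hq i, fun i => ?_⟩
  obtain ⟨r, hr⟩ := Finset.dvd_prod_of_mem q (Finset.mem_univ i)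
  rw [hr, pow_mul, ← inv_pow]
  exact (hqt i).imp (fun h => h.pow_right r) fun h => h.pow_right r

/-! ### A free action, and the obstruction for locally finite groups -/

/-- The Bernoulli action of a countably infinite group, with base space the unit interval. -/
theorem exists_isFreePMP (G : Type u) [Group G] [Countable G] [Infinite G] :
    ∃ (X : Type v) (_ : MeasurableSpace X) (_ : StandardBorelSpace X) (_ : MulAction G X)
      (μ : Measure X), IsFreePMP G μ := by
  obtain ⟨e⟩ : Nonempty (G ≃ ULift.{v} ℕ) := nonempty_equiv_of_countable
  let act : MulAction G (ULift.{v} ℕ → unitInterval) :=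
    { smul := fun g x i => x (e (g⁻¹ * e.symm i))
      one_smul := fun x => by
        change (fun i => x (e (1⁻¹ * e.symm i))) = x
        simp
      mul_smul := fun g h x => by
        change (fun i => x (e ((g * h)⁻¹ * e.symm i))) =
          fun i => x (e (h⁻¹ * e.symm (e (g⁻¹ * e.symm i))))
        simp [mul_assoc] }
  have hact : ∀ (g : G) (x : ULift.{v} ℕ → unitInterval),
      g • x = fun i => x (e (g⁻¹ * e.symm i)) := fun _ _ => rfl
  refine ⟨ULift.{v} ℕ → unitInterval, inferInstance, inferInstance, act,
    Measure.infinitePi fun _ => volume, inferInstance, fun g => ⟨?_, ?_⟩, ?_⟩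
  · simp only [hact]
    fun_prop
  · simp only [hact]
    exact Measure.map_infinitePi_infinitePi_of_inj (P := fun _ : ULift.{v} ℕ =>
      (volume : Measure unitInterval))
      (f := fun i => e (g⁻¹ * e.symm i)) fun i j hij => by simpa using hij
  · refine ae_all_iff.2 fun s => ?_
    by_cases hs : s = 1
    · simp [hs]
    have hne : e 1 ≠ e s := fun h => hs (e.injective h).symm
    -- A point fixed by s has equal coordinates at 1 and s; these are independent and uniform, so
    -- the diagonal is null.
    have hmap := Measure.infinitePi_map_eval_prod (P := fun _ : ULift.{v} ℕ =>
      (volume : Measure unitInterval)) hne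
    have hdiag : ((volume : Measure unitInterval).prod volume) {p | p.1 = p.2} = 0 := by
      have hm : MeasurableSet {p : unitInterval × unitInterval | p.1 = p.2} :=
        measurableSet_eq_fun measurable_fst measurable_snd
      rw [Measure.prod_apply hm]
      simp [Set.preimage]
    rw [← hmap, Measure.map_apply (by fun_prop)
      (measurableSet_eq_fun measurable_fst measurable_snd)] at hdiag
    refine (measure_eq_zero_iff_ae_notMem.1 hdiag).mono fun x hx _ hsx => hx ?_
    have := congrFun hsx (e s)
    rw [hact] at this
    simpa using this

theorem IsActionPath.exists_mem_closure {G : Type*} [Group G] {X : Type*} [MulAction G X]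
    {S : Finset G} {n : ℕ} {p : Fin (n + 1) → X} (hp : IsActionPath S p) (i : Fin (n + 1)) :
    ∃ h ∈ Subgroup.closure (S : Set G), p i = h • p 0 := by
  induction i using Fin.induction with
  | zero => exact ⟨1, one_mem _, (one_smul _ _).symm⟩
  | succ i ih =>
    obtain ⟨h, hh, hp'⟩ := ih
    obtain ⟨g, hg, hgp⟩ := hp i
    exact ⟨g * h, mul_mem (Subgroup.subset_closure hg) hh, by rw [hgp, hp', mul_smul]⟩

theorem IsFreePMP.one_le_card_mul {G : Type*} [Group G] {X : Type*} [MeasurableSpace X]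
    [MulAction G X] {μ : Measure X} (h : IsFreePMP G μ) {S : Finset G} {V : Set X}
    (hV : MeasurableSet V) (hSV : (S : Set G) • V = Set.univ) :
    1 ≤ (S.card : ℝ) * μ.real V := by
  have := h.isProbabilityMeasure
  rw [← probReal_univ (μ := μ), ← hSV, ← Set.iUnion_smul_set]
  refine (measureReal_biUnion_finset_le S fun g => g • V).trans (le_of_eq ?_)
  simp [h.measureReal_smul _ hV]

/-- Paths stay in orbits of the finite group E = ⟨S₁⟩, so V ⊆ E Z whatever C is. Taking δ =
1/(2|S||E|) contradicts 1 ≤ |S| μ(V). -/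
theorem HasShrinkingProperty.not_isLocallyFiniteGroup {G : Type u} [Group G] [Countable G]
    [Infinite G] (h : HasShrinkingProperty.{u, v} G) : ¬ IsLocallyFiniteGroup G := by
  intro hlf
  obtain ⟨S₁, hS₁, h⟩ := h
  have hfin : Finite (Subgroup.closure (S₁ : Set G)) := hlf _ ⟨S₁, rfl⟩
  obtain ⟨S, hS, h⟩ := h 1 one_pos
  set E : Finset G := (Set.toFinite (Subgroup.closure (S₁ : Set G) : Set G)).toFinset with hE
  have hS0 : 0 < S.card := Finset.card_pos.2 ⟨1, hS.1⟩
  have hE0 : 0 < E.card := Finset.card_pos.2 ⟨1, by simp [hE, one_mem]⟩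
  obtain ⟨C, h⟩ := h (1 / (2 * S.card * E.card)) (by positivity)
  obtain ⟨X, _, _, _, μ, hμ⟩ := exists_isFreePMP.{u, v} G
  have := hμ.isProbabilityMeasure
  obtain ⟨Z, V, hZ, hV, hZV, hSV, -, hμZ, hp⟩ := h X μ hμ
  have hVZ : V ⊆ ⋃ g ∈ E, g • Z := fun x hx => by
    obtain ⟨n, -, p, hp, h0, hl, -⟩ := hp x hx
    obtain ⟨g, hg, hgp⟩ := hp.exists_mem_closure (Fin.last n)
    refine Set.mem_biUnion (x := g⁻¹) (by simpa [hE] using hg) ?_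
    rw [Set.mem_smul_set_iff_inv_smul_mem, inv_inv, ← h0, ← hgp]
    exact hl
  have h1 : μ.real V ≤ E.card * μ.real Z := by
    refine (measureReal_mono hVZ (measure_ne_top _ _)).trans ((measureReal_biUnion_finset_le _ _).trans (le_of_eq ?_))
    simp [hμ.measureReal_smul _ hZ]
  have h2 : μ.real Z ≤ 1 / (2 * S.card * E.card) :=
    ENNReal.toReal_le_of_le_ofReal (by positivity) hμZ
  have h3 := hμ.one_le_card_mul hV hSV
  have h4 : (S.card : ℝ) * μ.real V ≤ 1 / 2 := by
    calc (S.card : ℝ) * μ.real V ≤ S.card * (E.card * (1 / (2 * S.card * E.card))) := by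
          gcongr; exact h1.trans (by gcongr)
      _ = 1 / 2 := by field_simp
  linarith

/-! ### The obstruction for virtually cyclic groups -/

/-- Between two visits to `A` separated by a gap there are visits to `Q`, so that gaps are at most
a constant factor more frequent than visits to `Q`. -/
theorem card_gaps_le {A Q : Set ℤ} {gap : ℤ → Prop} {ζ : ℤ → ℤ} {K B : ℕ}
    (hA : ∀ i : ℤ, ∃ k ∈ A, i ≤ k ∧ k < i + K) (hζ : ∀ k ∈ A, ζ k ∈ Q ∧ ζ k ≤ k + B)
    (hge : ∀ i k, gap i → k ∈ A → i ≤ k → i ≤ ζ k)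
    (hlt : ∀ i k, gap i → k ∈ A → k < i → ζ k < i) (N : ℕ)
    [DecidablePred fun i : ℕ => gap i] [DecidablePred fun i : ℕ => (i : ℤ) ∈ Q] :
    ((Finset.range N).filter fun i : ℕ => gap i).card ≤
      K * ((Finset.range (N + K + B)).filter fun i : ℕ => (i : ℤ) ∈ Q).card := by
  classical
  have hex : ∀ i : ℤ, ∃ j : ℕ, j < K ∧ i + j ∈ A := fun i => by
    obtain ⟨k, hk, h1, h2⟩ := hA i
    exact ⟨(k - i).toNat, by lia, by rwa [show i + ((k - i).toNat : ℤ) = k by lia]⟩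
  let w : ℤ → ℕ := fun i => Nat.find (hex i)
  have hwK : ∀ i, w i < K := fun i => (Nat.find_spec (hex i)).1
  have hwA : ∀ i, i + w i ∈ A := fun i => (Nat.find_spec (hex i)).2
  have hwmin : ∀ i k, k ∈ A → i ≤ k → i + w i ≤ k := fun i k hk hik => by
    by_contra! hlt'
    have hwi := hwK i
    exact Nat.find_min (hex i) (m := (k - i).toNat) (show (k - i).toNat < w i by lia)
      ⟨by lia, by rwa [show i + ((k - i).toNat : ℤ) = k by lia]⟩
  -- Equal waiting times to the next visit to `A` force the visit after i to precede i'. The gap at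
  -- i' then separates the two values of ζ, so the pair (waiting time, ζ) determines the gap.
  have hinj : ∀ i i', gap i → gap i' → i < i' → w i = w i' →
      ζ (i + w i) = ζ (i' + w i') → False := by
    intro i i' _ hi' hii hw hz
    have h1 : i + w i < i' := by
      by_contra! hle
      have := hwmin i' _ (hwA i) hle
      lia
    have h2 := hlt i' _ hi' (hwA i) h1
    have h3 := hge i' _ hi' (hwA i') (by lia)
    lia
  rw [← Finset.card_range K, ← Finset.card_product, Finset.card_range]
  refine Finset.card_le_card_of_injOn (fun i => (w i, (ζ (i + w i)).toNat)) ?_ ?_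
  · intro i hi
    simp only [Finset.coe_filter, Finset.mem_range, Set.mem_ofPred_eq] at hi
    obtain ⟨hiN, hi⟩ := hi
    have h1 := hge i _ hi (hwA i) (by lia)
    have h2 := hζ _ (hwA i)
    have h3 := hwK i
    simp only [Finset.coe_product, Finset.coe_range, Finset.coe_filter, Set.mem_prod,
      Set.mem_Iio, Finset.mem_range, Set.mem_ofPred_eq]
    refine ⟨h3, by lia, ?_⟩
    rw [Int.toNat_of_nonneg (by lia)]
    exact h2.1
  · intro i hi j hj hij
    simp only [Finset.coe_filter, Finset.mem_range, Set.mem_ofPred_eq] at hi hj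
    simp only [Prod.mk.injEq] at hij
    have h1 := hge i _ hi.2 (hwA i) (by lia)
    have h2 := hge j _ hj.2 (hwA j) (by lia)
    have h3 : ζ (i + w i) = ζ (j + w j) := by lia
    rcases lt_trichotomy i j with h | h | h
    · exact (hinj i j hi.2 hj.2 (by exact_mod_cast h) hij.1 h3).elim
    · exact h
    · exact (hinj j i hj.2 hi.2 (by exact_mod_cast h) hij.1.symm h3.symm).elim

/-- Integrating the count over x turns a combinatorial bound on orbits into one on measures, with no
ergodic theorem. -/
theorem sum_measure_le_of_card_le {X : Type*} [MeasurableSpace X] {μ : Measure X} {ι : Type*}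
    {s t : Finset ι} {A B : ι → Set X} (hA : ∀ i, MeasurableSet (A i))
    (hB : ∀ i, MeasurableSet (B i)) {K : ℕ} [∀ x, DecidablePred fun i => x ∈ A i]
    [∀ x, DecidablePred fun i => x ∈ B i]
    (h : ∀ x, (s.filter fun i => x ∈ A i).card ≤ K * (t.filter fun i => x ∈ B i).card) :
    ∑ i ∈ s, μ (A i) ≤ K * ∑ i ∈ t, μ (B i) := by
  have hsum : ∀ (r : Finset ι) (D : ι → Set X) (_ : ∀ i, MeasurableSet (D i))
      [∀ x, DecidablePred fun i => x ∈ D i],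
      ∑ i ∈ r, μ (D i) = ∫⁻ x, ((r.filter fun i => x ∈ D i).card : ENNReal) ∂μ := by
    intro r D hD _
    have : ∀ x, ((r.filter fun i => x ∈ D i).card : ENNReal) =
        ∑ i ∈ r, (D i).indicator (fun _ => 1) x := fun x => by
      rw [Finset.card_filter]
      push_cast
      exact Finset.sum_congr rfl fun i _ => by simp [Set.indicator_apply]
    simp only [this]
    rw [lintegral_finsetSum _ fun i _ => measurable_const.indicator (hD i)]
    exact Finset.sum_congr rfl fun i _ => by simp [lintegral_indicator (hD i)]
  rw [hsum s A hA, hsum t B hB, ← lintegral_const_mul' _ _ (ENNReal.natCast_ne_top K)]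
  refine lintegral_mono fun x => ?_
  dsimp only
  rw [← Nat.cast_mul]
  exact Nat.cast_le.2 (h x)

/-- A height function on a virtually infinite-cyclic group. -/
theorem exists_height_of_isVirtuallyCyclic {G : Type*} [Group G] [Infinite G]
    (hG : IsVirtuallyCyclic G) :
    ∃ (a : G) (ht : G → ℤ), (∀ g (k : ℤ), ht (g * a ^ k) = ht g + k) ∧ {g | ht g = 0}.Finite := by
  obtain ⟨H, hfin, hcyc⟩ := hG
  obtain ⟨a, rfl⟩ := (Subgroup.isCyclic_iff_exists_zpowers_eq_top _).1 hcyc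
  have ha : ¬ IsOfFinOrder a := fun h => by
    have : Finite (Subgroup.zpowers a) := finite_zpowers.2 h
    have hcard := (Subgroup.zpowers a).card_mul_index
    rw [Nat.card_eq_zero_of_infinite (α := G), mul_eq_zero] at hcard
    exact hcard.elim Nat.card_pos.ne' hfin.index_ne_zero
  have hinj : Function.Injective fun k : ℤ => a ^ k := injective_zpow_iff_not_isOfFinOrder.2 ha
  -- The height is the exponent of a relative to the chosen coset representative, so height zero
  -- means being a representative.
  have hex : ∀ g : G, ∃ k : ℤ, a ^ k = ((g : G ⧸ Subgroup.zpowers a).out)⁻¹ * g := fun g =>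
    Subgroup.mem_zpowers_iff.1 (QuotientGroup.eq.1 (QuotientGroup.out_eq' _))
  choose ht hht using hex
  refine ⟨a, ht, fun g k => hinj ?_, ?_⟩
  · have hq : ((g * a ^ k : G) : G ⧸ Subgroup.zpowers a) = g :=
      QuotientGroup.eq.2 ⟨-k, by simp⟩
    dsimp only
    rw [hht, hq, zpow_add, hht, mul_assoc]
  · refine (Set.finite_range fun q : G ⧸ Subgroup.zpowers a => q.out).subset fun g hg => ?_
    have := hht g
    rw [Set.mem_ofPred_eq] at hg
    rw [hg, zpow_zero] at this
    exact ⟨g, (inv_mul_eq_one.1 this.symm)⟩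

/-- The displacement is invariant under right multiplication by powers of a, so only the finitely
many g of height zero matter. -/
theorem exists_height_displacement_bound {G : Type*} [Group G] {a : G} {ht : G → ℤ}
    (hadd : ∀ g (k : ℤ), ht (g * a ^ k) = ht g + k) (hfin : {g | ht g = 0}.Finite)
    (S : Finset G) : ∃ L : ℕ, 0 < L ∧ ∀ s ∈ S, ∀ g, |ht (s * g) - ht g| ≤ L := by
  set T := hfin.toFinset
  refine ⟨(S.sup fun s => T.sup fun t => (ht (s * t)).natAbs) + 1, by lia, fun s hs g => ?_⟩
  have hT : g * a ^ (-ht g) ∈ T := hfin.mem_toFinset.2 (by rw [Set.mem_ofPred_eq, hadd]; ring)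
  have h1 : ht (s * g) - ht g = ht (s * (g * a ^ (-ht g))) := by
    rw [← mul_assoc, hadd]; ring
  have h2 := (Finset.le_sup (f := fun t => (ht (s * t)).natAbs) hT).trans
    (Finset.le_sup (f := fun s => T.sup fun t => (ht (s * t)).natAbs) hs)
  rw [h1, Int.abs_eq_natAbs]
  exact_mod_cast h2.trans (Nat.le_succ _)

/-- A path moving by bounded steps cannot jump over a gap. -/
theorem IsActionPath.exists_height_le {G : Type*} [Group G] {X : Type*} [MulAction G X]
    {S : Finset G} {ht : G → ℤ} {L : ℕ} (hL : ∀ s ∈ S, ∀ g, |ht (s * g) - ht g| ≤ L)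
    {V : Set X} {n : ℕ} {p : Fin (n + 1) → X} (hp : IsActionPath S p) (hV : ∀ i, p i ∈ V)
    {x : X} {g : G} (h0 : p 0 = g • x) (i : Fin (n + 1)) :
    ∃ h : G, p i = h • x ∧ ht h ≤ ht g + i * L ∧
      ∀ m : ℤ, (∀ g', m ≤ ht g' → ht g' < m + L → g' • x ∉ V) →
        (m ≤ ht g → m ≤ ht h) ∧ (ht g < m → ht h < m) := by
  induction i using Fin.induction with
  | zero => exact ⟨g, h0, by simp, fun m _ => ⟨id, id⟩⟩
  | succ i ih =>
    obtain ⟨h, hh, hle, hgap⟩ := ih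
    obtain ⟨s, hs, hsp⟩ := hp i
    have hd := abs_le.1 (hL s hs h)
    have hnV : ∀ h' : G, p i.castSucc = h' • x → h' • x ∈ V := fun h' e => e ▸ hV _
    have hs' : p i.succ = (s * h) • x := by rw [hsp, hh, mul_smul]
    have hmV : (s * h) • x ∈ V := hs' ▸ hV _
    refine ⟨s * h, hs', ?_, fun m hm => ?_⟩
    · rw [Fin.val_succ, Nat.cast_succ, add_mul, one_mul]
      rw [Fin.val_castSucc] at hle
      linarith
    · have h1 : ¬ (m ≤ ht h ∧ ht h < m + L) := fun h' => hm h h'.1 h'.2 (hnV h hh)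
      have h2 : ¬ (m ≤ ht (s * h) ∧ ht (s * h) < m + L) := fun h' => hm _ h'.1 h'.2 hmV
      have h3 := hgap m hm
      constructor
      · intro h4
        have := h3.1 h4
        lia
      · intro h4
        have := h3.2 h4
        lia

/-- The order of choices matters: S₁ fixes L and hence ε, S fixes K and hence δ, and only then does
C appear. C affects just the overhang of the counting window, which a long window absorbs. -/
theorem HasShrinkingProperty.not_isVirtuallyCyclic {G : Type u} [Group G] [Countable G]
    [Infinite G] (h : HasShrinkingProperty.{u, v} G) : ¬ IsVirtuallyCyclic G := by
  classical
  intro hvc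
  obtain ⟨a, ht, hadd, hfin⟩ := exists_height_of_isVirtuallyCyclic hvc
  obtain ⟨S₁, hS₁, h⟩ := h
  obtain ⟨L, hL0, hL⟩ := exists_height_displacement_bound hadd hfin S₁
  set T := hfin.toFinset
  have hT : ∀ g, g * a ^ (-ht g) ∈ T := fun g =>
    hfin.mem_toFinset.2 (by rw [Set.mem_ofPred_eq, hadd]; ring)
  have hT0 : 0 < T.card := Finset.card_pos.2 ⟨_, hT 1⟩
  obtain ⟨S, hS, h⟩ := h (1 / (2 * T.card * L)) (by positivity)
  obtain ⟨K₀, -, hK₀⟩ := exists_height_displacement_bound hadd hfin S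
  -- Starting from height i + K₀, an element of S leads into `V` at a height between i and i + 2 K₀.
  set K := 2 * K₀ + 1
  have hK0 : 0 < K := by lia
  obtain ⟨C, h⟩ := h (1 / (8 * K * T.card)) (by positivity)
  obtain ⟨X, _, _, _, μ, hμ⟩ := exists_isFreePMP.{u, v} G
  have := hμ.isProbabilityMeasure
  obtain ⟨Z, V, hZ, hV, hZV, hSV, hμV, hμZ, hp⟩ := h X μ hμ
  set B := C * L
  -- The enlarged window then has length 2 `N`, and the count yields N/2 ≤ 2N/8.
  set N := K + B
  have hN0 : 0 < N := by lia
  have hpre : ∀ (g : G) {B : Set X}, MeasurableSet B → MeasurableSet {x | g • x ∈ B} :=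
    fun g B hB => hμ.measurable_smul g hB
  have hpreμ : ∀ (g : G) {B : Set X}, MeasurableSet B → μ {x | g • x ∈ B} = μ B :=
    fun g B hB => (hμ.measurePreserving g).measure_preimage hB.nullMeasurableSet
  -- The elements t a^k are those of heights 0, …, L - 1, so outside `bad` a gap starts at height 0;
  -- by the choice of ε this has probability at least 1/2.
  set bad : Set X := ⋃ t ∈ T, ⋃ k ∈ Finset.range L, {x | (t * a ^ k) • x ∈ V} with hbad
  have hbadm : MeasurableSet bad := Finset.measurableSet_biUnion _ fun t _ =>
    Finset.measurableSet_biUnion _ fun k _ => hpre _ hV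
  have hbadμ : μ.real bad ≤ 1 / 2 := by
    have h1 : μ.real bad ≤ T.card * (L * μ.real V) := by
      refine (measureReal_biUnion_finset_le _ _).trans ((Finset.sum_le_sum fun t _ =>
        measureReal_biUnion_finset_le _ _).trans (le_of_eq ?_))
      simp [Measure.real, hpreμ _ hV]
    have h2 : μ.real V ≤ 1 / (2 * T.card * L) :=
      ENNReal.toReal_le_of_le_ofReal (by positivity) hμV
    calc μ.real bad ≤ T.card * (L * (1 / (2 * T.card * L))) := h1.trans (by gcongr)
      _ = 1 / 2 := by field_simp
  have hgood : 1 / 2 ≤ μ.real badᶜ := by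
    rw [probReal_compl_eq_one_sub hbadm]
    linarith
  let Dg : ℕ → Set X := fun i => {x | a ^ i • x ∈ badᶜ}
  let Zl : ℕ → Set X := fun i => ⋃ t ∈ T, {x | (t * a ^ i) • x ∈ Z}
  have hDm : ∀ i, MeasurableSet (Dg i) := fun i => hpre _ hbadm.compl
  have hZm : ∀ i, MeasurableSet (Zl i) := fun i => Finset.measurableSet_biUnion _ fun t _ =>
    hpre _ hZ
  have hcount : ∀ x, ((Finset.range N).filter fun i => x ∈ Dg i).card ≤
      K * ((Finset.range (N + K + B)).filter fun i => x ∈ Zl i).card := by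
    intro x
    let gap : ℤ → Prop := fun m => ∀ g', m ≤ ht g' → ht g' < m + L → g' • x ∉ V
    have hex : ∀ k ∈ {k : ℤ | ∃ g, ht g = k ∧ g • x ∈ V}, ∃ z : ℤ, (∃ g, ht g = z ∧ g • x ∈ Z) ∧
        z ≤ k + B ∧ ∀ m, gap m → (m ≤ k → m ≤ z) ∧ (k < m → z < m) := by
      rintro _ ⟨g, rfl, hg⟩
      obtain ⟨n, hn, p, hpath, h0, hl, hpV⟩ := hp _ hg
      obtain ⟨g', hg', hle, hgap⟩ := hpath.exists_height_le hL hpV h0 (Fin.last n)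
      refine ⟨ht g', ⟨g', rfl, hg' ▸ hl⟩, hle.trans ?_, hgap⟩
      rw [Fin.val_last]
      have : n * L ≤ C * L := Nat.mul_le_mul_right _ hn
      have : (n : ℤ) * L ≤ (B : ℤ) := by exact_mod_cast this
      linarith
    choose! ζ hζ1 hζ2 hζ3 using hex
    refine le_trans (Finset.card_le_card fun i hi => ?_) ((card_gaps_le
      (A := {k : ℤ | ∃ g, ht g = k ∧ g • x ∈ V}) (Q := {k : ℤ | ∃ g, ht g = k ∧ g • x ∈ Z})
      (gap := gap) (ζ := ζ) (K := K) (B := B) (fun i => ?_) (fun k hk => ⟨hζ1 k hk, hζ2 k hk⟩)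
      (fun i k hi hk => (hζ3 k hk i hi).1) (fun i k hi hk => (hζ3 k hk i hi).2) N).trans
        (Nat.mul_le_mul_left K (Finset.card_le_card fun i hi => ?_)))
    · rw [Finset.mem_filter] at hi ⊢
      refine ⟨hi.1, fun g h1 h2 hgV => hi.2 ?_⟩
      refine Set.mem_biUnion (Finset.mem_coe.2 (hT g)) (Set.mem_biUnion (x := (ht g - i).toNat)
        (Finset.mem_coe.2 (Finset.mem_range.2 (by lia))) ?_)
      rw [Set.mem_ofPred_eq, ← mul_smul]
      have : g * a ^ (-ht g) * a ^ (ht g - i).toNat * a ^ i = g := by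
        rw [← zpow_natCast a (ht g - i).toNat, Int.toNat_of_nonneg (by lia), ← zpow_natCast,
          mul_assoc, mul_assoc, ← zpow_add, ← zpow_add]
        simp
      rwa [this]
    · have hg₀ : ht (1 * a ^ (-ht 1) * a ^ (i + K₀)) = i + K₀ := by simp only [hadd]; lia
      set g := 1 * a ^ (-ht 1) * a ^ (i + K₀)
      obtain ⟨s, hs, v, hv, hsv⟩ := Set.mem_smul.1 (hSV ▸ Set.mem_univ (g • x))
      have hd := abs_le.1 (hK₀ s⁻¹ (hS.2 s hs) g)
      refine ⟨ht (s⁻¹ * g), ⟨s⁻¹ * g, rfl, ?_⟩, by lia, by lia⟩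
      rwa [mul_smul, ← hsv, inv_smul_smul]
    · rw [Finset.mem_filter] at hi ⊢
      obtain ⟨hi1, g, hg, hgZ⟩ := hi
      refine ⟨hi1, Set.mem_biUnion (Finset.mem_coe.2 (hT g)) ?_⟩
      rw [Set.mem_ofPred_eq, hg, ← zpow_natCast, mul_assoc, ← zpow_add]
      simpa using hgZ
  have hsum := sum_measure_le_of_card_le (μ := μ) hDm hZm hcount
  have hZle : ∀ i, μ (Zl i) ≤ T.card * μ Z := fun i => by
    refine (measure_biUnion_finset_le _ _).trans (le_of_eq ?_)
    simp [hpreμ _ hZ]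
  have hfinal : (N : ENNReal) * μ badᶜ ≤ K * ((N + K + B : ℕ) * (T.card * μ Z)) := by
    calc (N : ENNReal) * μ badᶜ = ∑ i ∈ Finset.range N, μ (Dg i) := by
          simp only [Dg, hpreμ _ hbadm.compl, Finset.sum_const, Finset.card_range, nsmul_eq_mul]
      _ ≤ K * ∑ i ∈ Finset.range (N + K + B), μ (Zl i) := hsum
      _ ≤ K * ∑ i ∈ Finset.range (N + K + B), T.card * μ Z := by gcongr; exact hZle _
      _ = _ := by simp
  have hreal : (N : ℝ) * μ.real badᶜ ≤ K * ((N + K + B : ℕ) * (T.card * μ.real Z)) := by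
    have htop : (K : ENNReal) * ((N + K + B : ℕ) * (T.card * μ Z)) ≠ ⊤ := by finiteness
    have := ENNReal.toReal_mono htop hfinal
    simpa only [Measure.real, ENNReal.toReal_mul, ENNReal.toReal_natCast] using this
  have hZμ : μ.real Z ≤ 1 / (8 * K * T.card) :=
    ENNReal.toReal_le_of_le_ofReal (by positivity) hμZ
  have hN1 : (0 : ℝ) < N := by exact_mod_cast hN0
  have hlast : (N : ℝ) * (1 / 2) ≤ N * (1 / 4) := by
    calc (N : ℝ) * (1 / 2) ≤ N * μ.real badᶜ := by gcongr
      _ ≤ K * ((N + K + B : ℕ) * (T.card * (1 / (8 * K * T.card)))) := hreal.trans (by gcongr)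
      _ = N * (1 / 4) := by
        rw [show N + K + B = 2 * N by lia]
        push_cast
        field_simp
        norm_num
  linarith

theorem mainTheorem8 (G : Type u) [Group G] [Countable G] [Infinite G] :
    HasShrinkingProperty.{u, v} G ↔ (¬ IsLocallyFiniteGroup G ∧ ¬ IsVirtuallyCyclic G) :=
  ⟨fun h => ⟨h.not_isLocallyFiniteGroup, h.not_isVirtuallyCyclic⟩,
    fun h => hasShrinkingProperty_of_not_locallyFinite_of_not_virtuallyCyclic h.1 h.2⟩
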